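/- Let $s>0$, let $H\subset\mathbb{R}^2$ be any regular hexagon of side length $s$, and let $X,Y$ be independent random points, each uniformly distributed in the interior of $H$. Let $D=|X-Y|$ be their Euclidean distance, and put $$m=\frac{7\sqrt3}{30}-\frac{7}{90}+\frac1{60}\left[28\ln\left(2\sqrt3+3\right)+29\ln\left(2\sqrt3-3\right)\right].$$ Then $D$ and $D^2$ are integrable and $$\mathbb{E}[D]=s\,m,\qquad \mathbb{E}[D^2]=\frac56\,s^2,\qquad \operatorname{Var}(D)=s^2\left(\frac56-m^2\right).$$ For the unit hexagon ($s=1$) these moments are also given by $$\int_0^2 x f(x)\,dx=m,\qquad \int_0^2x^2f(x)\,dx=\frac56,$$ where both integrands are integrable on $[0,2]$ and $$f(d)=\frac23 d\cdot\begin{cases} \left(\frac23-\frac{2\pi}{9\sqrt3}\right)d^2-\frac83d+\frac{2\pi}{\sqrt3}, & 0\le d\le 1,\\[2pt] -\frac4{\sqrt3}\left(\frac{2d^2}3+1\right)\arcsin\frac{\sqrt3}{2d}+\frac{2\pi}{3\sqrt3}d^2-2\sqrt{4d^2-3}+\frac{10\pi}{3\sqrt3}, & 1\le d\le\sqrt3,\\[2pt]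 \frac4{\sqrt3}\left(\frac{d^2}3+4\right)\arcsin\frac{\sqrt3}{d}-\left(\frac{4\pi}{9\sqrt3}+\frac23\right)d^2+\frac{20}3\sqrt{d^2-3}-\frac{16\pi}{3\sqrt3}-4, & \sqrt3\le d\le 2,\\[2pt] 0, & \text{otherwise.} \end{cases}$$ Numerically, $m\approx 0.8262589495$ and $\frac56-m^2\approx 0.1506294817$, each with error at most $5\cdot10^{-11}$. -/

import Mathlib

open MeasureTheory ProbabilityTheory

noncomputable section

/-- The `k`-th vertex of the regular hexagon in the Euclidean plane `ℂ` with centre `c`, side length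
(equivalently, circumradius) `s` and one vertex in the direction `θ`. -/
def hexagonVertex (c : ℂ) (s θ : ℝ) (k : Fin 6) : ℂ :=
  c + (s : ℂ) * Complex.exp (((θ + (k : ℝ) * (Real.pi / 3) : ℝ) : ℂ) * Complex.I)

/-- The (closed, filled) regular hexagon with centre `c`, side length `s` and orientation `θ`. -/
def regularHexagon (c : ℂ) (s θ : ℝ) : Set ℂ :=
  convexHull ℝ (Set.range (hexagonVertex c s θ))

/-- The explicit density of the distance between two uniform points of a unit hexagon. -/
def hexagonDistanceDensity (d : ℝ) : ℝ :=
  if 0 ≤ d ∧ d ≤ 1 then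
    2 / 3 * d * ((2 / 3 - 2 * Real.pi / (9 * √3)) * d ^ 2 - 8 / 3 * d + 2 * Real.pi / √3)
  else if 1 ≤ d ∧ d ≤ √3 then
    2 / 3 * d * (-(4 / √3) * (2 * d ^ 2 / 3 + 1) * Real.arcsin (√3 / (2 * d))
      + 2 * Real.pi / (3 * √3) * d ^ 2 - 2 * √(4 * d ^ 2 - 3) + 10 * Real.pi / (3 * √3))
  else if √3 ≤ d ∧ d ≤ 2 then
    2 / 3 * d * (4 / √3 * (d ^ 2 / 3 + 4) * Real.arcsin (√3 / d)
      - (4 * Real.pi / (9 * √3) + 2 / 3) * d ^ 2 + 20 / 3 * √(d ^ 2 - 3)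
      - 16 * Real.pi / (3 * √3) - 4)
  else 0

/-- The closed form of the mean distance in a unit hexagon. -/
def hexagonMeanDistance : ℝ :=
  7 * √3 / 30 - 7 / 90 + 1 / 60 * (28 * Real.log (2 * √3 + 3) + 29 * Real.log (2 * √3 - 3))

end

/-! An affine isomorphism carries the hexagon to the model |a| ≤ 1, |b| ≤ 1, |a + b| ≤ 1 in the
oblique basis 1, ω = exp(iπ/3), where uniform laws correspond and the squared norm is a² + ab + b².
The model has area 3, so E[Φ(X − Y)] is 1/9 of the integral of Φ(v) g(v), with g(v) the area of the
intersection of the model with its translate by −v (`integral_hexagonModel_prod_sub`).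

If Φ has the symmetries of the hexagon, only one of twelve congruent sectors is needed
(`integral_eq_twelve_mul`). On the sector 0 ≤ w ≤ u ≤ 2 the overlap is g(u, w) = (2 − u)(2 − u − w)₊
− (1 − u)₊² (`hexagonCovariogram_eq`). If Φ is also homogeneous, the substitution w = uy separates
the variables: the u-integral is rational in y, and one integral over y in [0, 1] remains. For the
distance its integrand is √(1 + y + y²) times a rational weight, whence the logarithms
(`integral_sqrt_meanWeight`); for the squared distance it is rational.

The integrals against the explicit density are a separate computation: each branch has an elementary
primitive, and the terms in π cancel between branches. The agreement of values does not pass through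
a proof that f is the density of D. -/

/-! ### The remaining integrals over the slope y -/

/-- A primitive of `√(x² - x + 1)`. -/
noncomputable def sqrtPrimitive (x : ℝ) : ℝ :=
  (2 * x - 1) / 4 * √(x ^ 2 - x + 1) + 3 / 8 * Real.log (2 * x - 1 + 2 * √(x ^ 2 - x + 1))

theorem hasDerivAt_sqrtPrimitive (x : ℝ) :
    HasDerivAt sqrtPrimitive (√(x ^ 2 - x + 1)) x := by
  have hpos : 0 < x ^ 2 - x + 1 := by nlinarith [sq_nonneg (2 * x - 1)]
  set r := √(x ^ 2 - x + 1) with hr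
  have hr0 : 0 < r := Real.sqrt_pos.2 hpos
  have hr2 : r ^ 2 = x ^ 2 - x + 1 := Real.sq_sqrt hpos.le
  -- 4r² = (2x − 1)² + 3, hence 2r > |2x − 1|.
  have hlog : 0 < 2 * x - 1 + 2 * r := by
    by_contra h
    nlinarith
  have h1 : HasDerivAt (fun y : ℝ => y ^ 2 - y + 1) (2 * x - 1) x := by
    simpa using ((hasDerivAt_pow 2 x).sub (hasDerivAt_id x)).add_const 1
  have h2 := h1.sqrt hpos.ne'
  have h3 : HasDerivAt (fun y : ℝ => 2 * y - 1) 2 x := by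
    simpa using ((hasDerivAt_id x).const_mul 2).sub_const 1
  have h4 := (h3.add (h2.const_mul 2)).log hlog.ne'
  refine (((h3.div_const 4).mul h2).add (h4.const_mul (3 / 8))).congr_deriv ?_
  simp only [← hr, Pi.add_apply]
  field_simp
  have : x ^ 2 = r ^ 2 + x - 1 := by linarith
  ring_nf
  simp only [show r ^ 3 = r * r ^ 2 by ring, hr2]
  ring

theorem sqrt_inv_add_one {y : ℝ} (hy : 0 ≤ y) :
    √((1 / (1 + y)) ^ 2 - 1 / (1 + y) + 1) = √(1 + y + y ^ 2) / (1 + y) := by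
  have h : 0 < 1 + y := by linarith
  rw [show (1 / (1 + y)) ^ 2 - 1 / (1 + y) + 1 = (1 + y + y ^ 2) / (1 + y) ^ 2 by field_simp; ring,
    Real.sqrt_div (by positivity), Real.sqrt_sq h.le]

/-- The arguments multiply to 12 − 9 = 3. This one relation brings every logarithm that arises into
the two used in the closed form. -/
theorem log_two_sqrt_three_add_log :
    Real.log (2 * √3 + 3) + Real.log (2 * √3 - 3) = Real.log 3 := by
  have h3 : √3 ^ 2 = (3 : ℝ) := Real.sq_sqrt (by norm_num)
  have h : (3 : ℝ) < 2 * √3 := by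
    have := Real.lt_sqrt (x := 3 / 2) (y := 3) (by norm_num)
    have := this.2 (by norm_num)
    linarith
  rw [← Real.log_mul (by positivity) (by linarith)]
  congr 1
  linarith

/-- With z = 1/(1 + y) one has √(1 + y + y²) = √(z² − z + 1)/z and dy = −dz/z², so the cubic and
quartic terms become √(z² − z + 1) dz and z√(z² − z + 1) dz up to constants. Writing z = (2z − 1)/2
+ 1/2 in the latter yields the cube of the root and another `sqrtPrimitive`. The term 1/30 is
integrated directly at −y. -/
theorem integral_sqrt_meanWeight :
    ∫ y in (0 : ℝ)..1, √(1 + y + y ^ 2) * (8 / (3 * (1 + y) ^ 3) - 8 / (5 * (1 + y) ^ 4) - 1 / 30)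
      = 3 / 4 * hexagonMeanDistance := by
  have hderiv : ∀ y ∈ Set.uIcc (0 : ℝ) 1, HasDerivAt
      (fun y : ℝ => 8 / 15 * (√((1 / (1 + y)) ^ 2 - 1 / (1 + y) + 1)) ^ 3
        - (8 / 3 - 4 / 5) * sqrtPrimitive (1 / (1 + y)) + 1 / 30 * sqrtPrimitive (-y))
      (√(1 + y + y ^ 2) * (8 / (3 * (1 + y) ^ 3) - 8 / (5 * (1 + y) ^ 4) - 1 / 30)) y := by
    intro y hy
    rw [Set.uIcc_of_le zero_le_one] at hy
    have h : 0 < 1 + y := by linarith [hy.1]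
    have hz : HasDerivAt (fun y : ℝ => 1 / (1 + y)) (-1 / (1 + y) ^ 2) y := by
      simpa only [one_div, id_eq] using ((hasDerivAt_id y).const_add 1).fun_inv h.ne'
    have hpos : 0 < (1 / (1 + y)) ^ 2 - 1 / (1 + y) + 1 := by
      nlinarith [sq_nonneg (2 * (1 / (1 + y)) - 1)]
    have h1 := (((hz.pow 2).sub hz).add_const 1).sqrt hpos.ne'
    have h2 := (hasDerivAt_sqrtPrimitive (1 / (1 + y))).comp y hz
    have h3 := (hasDerivAt_sqrtPrimitive (-y)).comp y (hasDerivAt_neg y)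
    refine ((((h1.pow 3).const_mul (8 / 15)).sub (h2.const_mul (8 / 3 - 4 / 5))).add
      (h3.const_mul (1 / 30))).congr_deriv ?_
    simp only [Pi.sub_apply, Pi.pow_apply, Nat.reduceSub, pow_one, Nat.cast_ofNat]
    rw [sqrt_inv_add_one hy.1, show (-y) ^ 2 - -y + 1 = 1 + y + y ^ 2 by ring]
    have hq : 0 < √(1 + y + y ^ 2) := Real.sqrt_pos.2 (by nlinarith [hy.1])
    field_simp
    ring
  rw [intervalIntegral.integral_eq_sub_of_hasDerivAt hderiv]
  · have h34 : √(3 / 4) = √3 / 2 := by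
      rw [Real.sqrt_div (by norm_num), show (4 : ℝ) = 2 ^ 2 by norm_num, Real.sqrt_sq (by norm_num)]
    have h3 : √3 ^ 3 = 3 * √3 := by
      rw [pow_succ, Real.sq_sqrt (by norm_num)]
    have hl : Real.log √3 = Real.log 3 / 2 := Real.log_sqrt (by norm_num)
    have hl' := log_two_sqrt_three_add_log
    simp only [sqrtPrimitive, hexagonMeanDistance]
    norm_num [h34]
    rw [show (2 : ℝ) * (√3 / 2) = √3 by ring, hl,
      show -3 + 2 * √3 = 2 * √3 - 3 by ring, div_pow, h3]
    linear_combination (-7/20 : ℝ) * hl'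
  · refine ContinuousOn.intervalIntegrable fun y hy => ContinuousAt.continuousWithinAt ?_
    rw [Set.uIcc_of_le zero_le_one] at hy
    have h : 0 < 1 + y := by linarith [hy.1]
    fun_prop (disch := positivity)

/-- The same substitution z = 1/(1 + y) makes the fractional part of the integrand polynomial in z.
-/
theorem integral_secondMomentWeight :
    ∫ y in (0 : ℝ)..1, (1 + y + y ^ 2)
      * (16 / (5 * (1 + y) ^ 4) - 32 / (15 * (1 + y) ^ 5) - 1 / 60) = 5 / 8 := by
  have hderiv : ∀ y ∈ Set.uIcc (0 : ℝ) 1, HasDerivAt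
      (fun y : ℝ => -(16 / 5) * (1 / (1 + y)) + 8 / 3 * (1 / (1 + y)) ^ 2
        - 16 / 9 * (1 / (1 + y)) ^ 3 + 8 / 15 * (1 / (1 + y)) ^ 4
        - (1 / 60 * y + 1 / 120 * y ^ 2 + 1 / 180 * y ^ 3))
      ((1 + y + y ^ 2) * (16 / (5 * (1 + y) ^ 4) - 32 / (15 * (1 + y) ^ 5) - 1 / 60)) y := by
    intro y hy
    rw [Set.uIcc_of_le zero_le_one] at hy
    have h : 0 < 1 + y := by linarith [hy.1]
    have hz : HasDerivAt (fun y : ℝ => 1 / (1 + y)) (-1 / (1 + y) ^ 2) y := by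
      simpa only [one_div, id_eq] using ((hasDerivAt_id y).const_add 1).fun_inv h.ne'
    refine (((((hz.const_mul (-(16 / 5))).add ((hz.pow 2).const_mul (8 / 3))).sub
      ((hz.pow 3).const_mul (16 / 9))).add ((hz.pow 4).const_mul (8 / 15))).sub
      ((((hasDerivAt_id y).const_mul (1 / 60)).add ((hasDerivAt_pow 2 y).const_mul (1 / 120))).add
        ((hasDerivAt_pow 3 y).const_mul (1 / 180)))).congr_deriv ?_
    norm_num
    field_simp
    ring
  rw [intervalIntegral.integral_eq_sub_of_hasDerivAt hderiv]
  · norm_num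
  · refine ContinuousOn.intervalIntegrable fun y hy => ContinuousAt.continuousWithinAt ?_
    rw [Set.uIcc_of_le zero_le_one] at hy
    have h : 0 < 1 + y := by linarith [hy.1]
    fun_prop (disch := positivity)

/-! ### Numerical enclosures -/

/-- log 3 = −log(1 − 2/3); after 80 terms of the series the remainder is at most 3(2/3)⁸¹, about
10⁻¹⁴. -/
theorem abs_log_three_sub_le : |Real.log 3 - 1.09861228866811| ≤ 1 / 10 ^ 12 := by
  have t : |(2 / 3 : ℝ)| = 2 / 3 := by rw [abs_of_pos]; norm_num
  have z := Real.abs_log_sub_add_sum_range_le (x := 2 / 3) (by norm_num) 80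
  rw [t, show (1 : ℝ) - 2 / 3 = 3⁻¹ by norm_num, Real.log_inv, ← sub_eq_add_neg,
    abs_sub_comm] at z
  have hs : |∑ i ∈ Finset.range 80, (2 / 3 : ℝ) ^ (i + 1) / (i + 1) - 1.09861228866811|
      ≤ 5 / 10 ^ 13 := by
    norm_num [Finset.sum_range_succ, abs_le]
  have hz : (2 / 3 : ℝ) ^ (80 + 1) / 3⁻¹ ≤ 5 / 10 ^ 13 := by norm_num
  calc _ ≤ _ := abs_sub_le _ (∑ i ∈ Finset.range 80, (2 / 3 : ℝ) ^ (i + 1) / (i + 1)) _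
    _ ≤ 5 / 10 ^ 13 + 5 / 10 ^ 13 := add_le_add (z.trans hz) hs
    _ ≤ _ := by norm_num

theorem sqrt_three_bounds : 1.7320508075688 < √3 ∧ √3 < (1.7320508075689 : ℝ) :=
  ⟨(Real.lt_sqrt (by norm_num)).2 (by norm_num), (Real.sqrt_lt' (by norm_num)).2 (by norm_num)⟩

theorem abs_log_two_add_sqrt_three_sub_le :
    |Real.log (2 + √3) - Real.log 3 - 0.2183456082567| ≤ 1 / 10 ^ 12 := by
  obtain ⟨hl, hu⟩ := sqrt_three_bounds
  have h3 : √3 ^ 2 = (3 : ℝ) := Real.sq_sqrt (by norm_num)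
  -- 3/(2 + √3) = 6 − 3√3 = 1 − (3√3 − 5), and 3√3 − 5 ≈ 0.196 makes the series converge fast. The
  -- two decimals below are 3t − 5 at the bounds t for √3.
  have hx : Real.log (2 + √3) - Real.log 3 = -Real.log (1 - (3 * √3 - 5)) := by
    rw [← Real.log_div (by positivity) (by norm_num), ← Real.log_inv]
    congr 1
    refine eq_inv_of_mul_eq_one_left ?_
    linarith
  have key : ∀ x : ℝ, 0 ≤ x → x ≤ 0.1961524227067 →
      |∑ i ∈ Finset.range 17, x ^ (i + 1) / (i + 1) + Real.log (1 - x)| ≤ 3 / 10 ^ 13 := by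
    intro x h0 h1
    have habs : |x| = x := abs_of_nonneg h0
    refine (Real.abs_log_sub_add_sum_range_le (by rw [habs]; linarith) 17).trans ?_
    rw [habs]
    calc x ^ (17 + 1) / (1 - x) ≤ 0.1961524227067 ^ (17 + 1) / (1 - 0.1961524227067) := by
          gcongr
      _ ≤ _ := by norm_num
  have k0 := abs_le.1 (key 0.1961524227064 (by norm_num) (by norm_num))
  have k1 := abs_le.1 (key 0.1961524227067 (by norm_num) (by norm_num))
  have m0 : Real.log (1 - (3 * √3 - 5)) ≤ Real.log (1 - 0.1961524227064) :=
    Real.log_le_log (by linarith) (by linarith)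
  have m1 : Real.log (1 - 0.1961524227067) ≤ Real.log (1 - (3 * √3 - 5)) :=
    Real.log_le_log (by norm_num) (by linarith)
  have s0 : 0.2183456082567 - 6 / 10 ^ 13 ≤
      ∑ i ∈ Finset.range 17, (0.1961524227064 : ℝ) ^ (i + 1) / (i + 1) := by
    norm_num [Finset.sum_range_succ]
  have s1 : ∑ i ∈ Finset.range 17, (0.1961524227067 : ℝ) ^ (i + 1) / (i + 1) ≤
      0.2183456082567 + 6 / 10 ^ 13 := by
    norm_num [Finset.sum_range_succ]
  rw [hx, abs_le]
  constructor <;> linarith [k0.1, k0.2, k1.1, k1.2]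

theorem abs_hexagonMeanDistance_sub_le :
    |hexagonMeanDistance - 0.82625894949023| ≤ 1 / 10 ^ 12 := by
  obtain ⟨hl, hu⟩ := sqrt_three_bounds
  have h3 : √3 ^ 2 = (3 : ℝ) := Real.sq_sqrt (by norm_num)
  have h1 := abs_le.1 abs_log_three_sub_le
  have h2 := abs_le.1 abs_log_two_add_sqrt_three_sub_le
  have h4 := log_two_sqrt_three_add_log
  -- 2√3 + 3 = √3 (2 + √3).
  have h5 : Real.log (2 * √3 + 3) = Real.log 3 / 2 + Real.log (2 + √3) := by
    rw [← Real.log_sqrt (by norm_num), ← Real.log_mul (by positivity) (by positivity)]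
    congr 1
    linarith
  rw [hexagonMeanDistance, abs_le]
  constructor <;> linarith [h1.1, h1.2, h2.1, h2.2]

theorem hexagonMeanDistance_approx : |hexagonMeanDistance - 0.8262589495| ≤ 5 / 10 ^ 11 := by
  have h := abs_le.1 abs_hexagonMeanDistance_sub_le
  rw [abs_le]
  constructor <;> linarith [h.1, h.2]

theorem hexagonDistanceVariance_approx :
    |5 / 6 - hexagonMeanDistance ^ 2 - 0.1506294817| ≤ 5 / 10 ^ 11 := by
  have h := abs_le.1 abs_hexagonMeanDistance_sub_le
  rw [abs_le]
  constructor <;> nlinarith [h.1, h.2]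

/-! ### Moments of the explicit density, branch by branch -/

theorem hasDerivAt_sqrt_four_sq_sub {x : ℝ} (hx : 1 < x) :
    HasDerivAt (fun y : ℝ => √(4 * y ^ 2 - 3)) (4 * x / √(4 * x ^ 2 - 3)) x := by
  have hpos : 0 < 4 * x ^ 2 - 3 := by nlinarith
  have h := ((((hasDerivAt_pow 2 x).const_mul 4).sub_const 3).sqrt hpos.ne')
  refine h.congr_deriv ?_
  norm_num
  field_simp

theorem hasDerivAt_sqrt_sq_sub {x : ℝ} (hx : √3 < x) :
    HasDerivAt (fun y : ℝ => √(y ^ 2 - 3)) (x / √(x ^ 2 - 3)) x := by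
  have hpos : 0 < x ^ 2 - 3 := by
    have := (Real.sqrt_lt' (by linarith [Real.sqrt_nonneg 3])).1 hx
    linarith
  have h := (((hasDerivAt_pow 2 x).sub_const 3).sqrt hpos.ne')
  refine h.congr_deriv ?_
  norm_num
  field_simp

theorem hasDerivAt_arcsin_const_div {k x : ℝ} (hk : 0 < k) (hx : k < x) :
    HasDerivAt (fun y : ℝ => Real.arcsin (k / y)) (-k / (x * √(x ^ 2 - k ^ 2))) x := by
  have hx0 : 0 < x := hk.trans hx
  have hlt : k / x < 1 := (div_lt_one hx0).2 hx
  have hgt : -1 < k / x := by linarith [div_pos hk hx0]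
  have h := ((hasDerivAt_inv hx0.ne').const_mul k)
  have h' := (Real.hasDerivAt_arcsin hgt.ne' hlt.ne).comp x
    (by simpa only [div_eq_mul_inv] using h : HasDerivAt (fun y : ℝ => k / y) _ x)
  refine h'.congr_deriv ?_
  have e : 1 - (k / x) ^ 2 = (x ^ 2 - k ^ 2) / x ^ 2 := by field_simp
  have hp : 0 < √(x ^ 2 - k ^ 2) := Real.sqrt_pos.2 (by nlinarith)
  rw [e, Real.sqrt_div' _ (by positivity), Real.sqrt_sq hx0.le]
  field_simp

theorem hasDerivAt_arcsin_sqrt_three_div_two_mul {x : ℝ} (hx : 1 < x) :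
    HasDerivAt (fun y : ℝ => Real.arcsin (√3 / (2 * y))) (-√3 / (x * √(4 * x ^ 2 - 3))) x := by
  have h3 : √3 < 2 := (Real.sqrt_lt' (by norm_num)).2 (by norm_num)
  have h := hasDerivAt_arcsin_const_div (k := √3 / 2) (x := x) (by positivity) (by linarith)
  have e : √(4 * x ^ 2 - 3) = 2 * √(x ^ 2 - (√3 / 2) ^ 2) := by
    rw [div_pow, Real.sq_sqrt (by norm_num),
      show 4 * x ^ 2 - 3 = 2 ^ 2 * (x ^ 2 - 3 / 2 ^ 2) by ring, Real.sqrt_mul (by norm_num),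
      Real.sqrt_sq (by norm_num)]
  simp only [div_div] at h
  refine h.congr_deriv ?_
  rw [e]
  field_simp

theorem hasDerivAt_log_two_mul_add_sqrt {x : ℝ} (hx : 1 < x) :
    HasDerivAt (fun y : ℝ => Real.log (2 * y + √(4 * y ^ 2 - 3))) (2 / √(4 * x ^ 2 - 3)) x := by
  have hw : 0 < √(4 * x ^ 2 - 3) := Real.sqrt_pos.2 (by nlinarith)
  have h := (((hasDerivAt_id x).const_mul 2).add (hasDerivAt_sqrt_four_sq_sub hx)).log
    (by simp; positivity)
  refine h.congr_deriv ?_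
  simp
  field_simp
  ring

theorem hasDerivAt_log_add_sqrt {x : ℝ} (hx : √3 < x) :
    HasDerivAt (fun y : ℝ => Real.log (y + √(y ^ 2 - 3))) (1 / √(x ^ 2 - 3)) x := by
  have hx0 : 0 < x := (Real.sqrt_nonneg 3).trans_lt hx
  have hw : 0 < √(x ^ 2 - 3) :=
    Real.sqrt_pos.2 (by linarith [(Real.sqrt_lt' hx0).1 hx])
  have h := ((hasDerivAt_id x).add (hasDerivAt_sqrt_sq_sub hx)).log (by simp; positivity)
  refine h.congr_deriv ?_
  simp
  field_simp
  ring

/-- Clears √3 from denominators, so that the boundary values become polynomials in √3 which `ring`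
can compare once √3² = 3 is substituted. -/
theorem inv_sqrt_three : (√3)⁻¹ = √3 * 3⁻¹ := by
  have hs : √3 ^ 2 = (3 : ℝ) := Real.sq_sqrt (by norm_num)
  rw [inv_eq_iff_eq_inv, mul_inv, inv_inv, eq_inv_mul_iff_mul_eq₀ (by positivity)]
  linarith

theorem arcsin_sqrt_three_div_two : Real.arcsin (√3 / 2) = Real.pi / 3 := by
  rw [← Real.sin_pi_div_three, Real.arcsin_sin] <;> linarith [Real.pi_pos]

theorem arcsin_one_half : Real.arcsin (1 / 2) = Real.pi / 6 := by
  rw [← Real.sin_pi_div_six, Real.arcsin_sin] <;> linarith [Real.pi_pos]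

theorem hexagonDistanceDensity_of_mem_Ioc_zero_one {x : ℝ} (hx : x ∈ Set.Ioc (0 : ℝ) 1) :
    hexagonDistanceDensity x =
      2 / 3 * x * ((2 / 3 - 2 * Real.pi / (9 * √3)) * x ^ 2 - 8 / 3 * x + 2 * Real.pi / √3) := by
  rw [hexagonDistanceDensity, if_pos ⟨hx.1.le, hx.2⟩]

theorem hexagonDistanceDensity_of_mem_Ioc_one_sqrt_three {x : ℝ} (hx : x ∈ Set.Ioc 1 √3) :
    hexagonDistanceDensity x =
      2 / 3 * x * (-(4 / √3) * (2 * x ^ 2 / 3 + 1) * Real.arcsin (√3 / (2 * x))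
      + 2 * Real.pi / (3 * √3) * x ^ 2 - 2 * √(4 * x ^ 2 - 3) + 10 * Real.pi / (3 * √3)) := by
  rw [hexagonDistanceDensity, if_neg fun h => absurd hx.1 h.2.not_gt, if_pos ⟨hx.1.le, hx.2⟩]

theorem hexagonDistanceDensity_of_mem_Ioc_sqrt_three_two {x : ℝ} (hx : x ∈ Set.Ioc √3 2) :
    hexagonDistanceDensity x =
      2 / 3 * x * (4 / √3 * (x ^ 2 / 3 + 4) * Real.arcsin (√3 / x)
      - (4 * Real.pi / (9 * √3) + 2 / 3) * x ^ 2 + 20 / 3 * √(x ^ 2 - 3)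
      - 16 * Real.pi / (3 * √3) - 4) := by
  have h1 : 1 < √3 := (Real.lt_sqrt (by norm_num)).2 (by norm_num)
  rw [hexagonDistanceDensity, if_neg fun h => absurd (h1.trans hx.1) h.2.not_gt,
    if_neg fun h => absurd hx.1 h.2.not_gt, if_pos ⟨hx.1.le, hx.2⟩]

/-- The fundamental theorem of calculus for an integrand given by a continuous formula on a
half-open interval. -/
theorem intervalIntegral_eq_sub_of_eqOn_Ioc {a b : ℝ} (hab : a ≤ b) {f g F : ℝ → ℝ}
    (hfg : ∀ x ∈ Set.Ioc a b, f x = g x) (hg : ContinuousOn g (Set.Icc a b))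
    (hF : ContinuousOn F (Set.Icc a b)) (hderiv : ∀ x ∈ Set.Ioo a b, HasDerivAt F (g x) x) :
    IntervalIntegrable f volume a b ∧ ∫ x in a..b, f x = F b - F a := by
  have hgi : IntervalIntegrable g volume a b := hg.intervalIntegrable_of_Icc hab
  constructor
  · refine hgi.congr fun x hx => ?_
    rw [Set.uIoc_of_le hab] at hx
    exact (hfg x hx).symm
  · rw [← intervalIntegral.integral_eq_sub_of_hasDerivAt_of_le hab hF hderiv hgi]
    refine intervalIntegral.integral_congr_ae (Filter.Eventually.of_forall fun x hx => ?_)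
    rw [Set.uIoc_of_le hab] at hx
    exact hfg x hx

theorem integral_mul_density_zero_one :
    IntervalIntegrable (fun x => x * hexagonDistanceDensity x) volume 0 1 ∧
    ∫ x in (0 : ℝ)..1, x * hexagonDistanceDensity x =
      2 / 3 * (-(8 / 15) + 28 / 45 * (Real.pi / √3)) := by
  have h := intervalIntegral_eq_sub_of_eqOn_Ioc (zero_le_one (α := ℝ))
    (f := fun x => x * hexagonDistanceDensity x)
    (F := fun x => 2 / 3 * ((2 / 3 - 2 * Real.pi / (9 * √3)) * (x ^ 5 / 5) - 8 / 3 * (x ^ 4 / 4)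
      + 2 * Real.pi / √3 * (x ^ 3 / 3)))
    (fun x hx => by rw [hexagonDistanceDensity_of_mem_Ioc_zero_one hx])
    (by fun_prop) (by fun_prop) (fun x _ => by
      refine (((((hasDerivAt_pow 5 x).div_const 5).const_mul _).sub
        (((hasDerivAt_pow 4 x).div_const 4).const_mul _)).add
        (((hasDerivAt_pow 3 x).div_const 3).const_mul _)).const_mul _ |>.congr_deriv ?_
      norm_num
      ring)
  refine ⟨h.1, h.2.trans ?_⟩
  norm_num
  field_simp
  ring

theorem integral_sq_mul_density_zero_one :
    IntervalIntegrable (fun x => x ^ 2 * hexagonDistanceDensity x) volume 0 1 ∧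
    ∫ x in (0 : ℝ)..1, x ^ 2 * hexagonDistanceDensity x =
      2 / 3 * (-(19 / 45) + 25 / 54 * (Real.pi / √3)) := by
  have h := intervalIntegral_eq_sub_of_eqOn_Ioc (zero_le_one (α := ℝ))
    (f := fun x => x ^ 2 * hexagonDistanceDensity x)
    (F := fun x => 2 / 3 * ((2 / 3 - 2 * Real.pi / (9 * √3)) * (x ^ 6 / 6) - 8 / 3 * (x ^ 5 / 5)
      + 2 * Real.pi / √3 * (x ^ 4 / 4)))
    (fun x hx => by rw [hexagonDistanceDensity_of_mem_Ioc_zero_one hx])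
    (by fun_prop) (by fun_prop) (fun x _ => by
      refine (((((hasDerivAt_pow 6 x).div_const 6).const_mul _).sub
        (((hasDerivAt_pow 5 x).div_const 5).const_mul _)).add
        (((hasDerivAt_pow 4 x).div_const 4).const_mul _)).const_mul _ |>.congr_deriv ?_
      norm_num
      ring)
  refine ⟨h.1, h.2.trans ?_⟩
  norm_num
  field_simp
  ring

theorem integral_mul_density_one_sqrt_three :
    IntervalIntegrable (fun x => x * hexagonDistanceDensity x) volume 1 √3 ∧
    ∫ x in (1 : ℝ)..√3, x * hexagonDistanceDensity x =
      2 / 3 * (46 / 15 * Real.pi - 97 / 20 * √3 - Real.log (2 * √3 + 3) / 40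
        - 28 / 45 * (Real.pi / √3) + 11 / 20 + Real.log 3 / 40) := by
  have h13 : 1 < √3 := (Real.lt_sqrt (by norm_num)).2 (by norm_num)
  have hne : ∀ x ∈ Set.Icc 1 √3, 2 * x ≠ 0 := fun x hx => by linarith [hx.1]
  have hlog : ∀ x ∈ Set.Icc 1 √3, 2 * x + √(4 * x ^ 2 - 3) ≠ 0 := fun x hx => by
    linarith [hx.1, Real.sqrt_nonneg (4 * x ^ 2 - 3)]
  have h := intervalIntegral_eq_sub_of_eqOn_Ioc h13.le
    (f := fun x => x * hexagonDistanceDensity x)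
    -- Integration by parts: 2x⁵/15 + x³/3 is a primitive of x²(2x²/3 + 1). The algebraic remainder
    -- from the derivative of arcsin, together with −2x²√(4x² − 3), is integrated by the root and
    -- logarithm terms.
    (F := fun x => 2 / 3 * (-(4 / √3) * ((2 / 15 * x ^ 5 + 1 / 3 * x ^ 3)
        * Real.arcsin (√3 / (2 * x)))
      + ((-(8 / 15) * x ^ 3 - 1 / 60 * x) * √(4 * x ^ 2 - 3)
        - 1 / 40 * Real.log (2 * x + √(4 * x ^ 2 - 3)))
      + (2 * Real.pi / (15 * √3) * x ^ 5 + 10 * Real.pi / (9 * √3) * x ^ 3)))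
    (fun x hx => by rw [hexagonDistanceDensity_of_mem_Ioc_one_sqrt_three hx])
    (by fun_prop (disch := assumption)) (by fun_prop (disch := assumption)) (fun x hx => by
      have hx0 : 0 < x := by linarith [hx.1]
      have hw : 0 < √(4 * x ^ 2 - 3) := Real.sqrt_pos.2 (by nlinarith [hx.1])
      have hw2 : √(4 * x ^ 2 - 3) ^ 2 = 4 * x ^ 2 - 3 := Real.sq_sqrt (by nlinarith [hx.1])
      refine (((((((hasDerivAt_pow 5 x).const_mul _).add ((hasDerivAt_pow 3 x).const_mul _)).mul
        (hasDerivAt_arcsin_sqrt_three_div_two_mul hx.1)).const_mul _).add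
        (((((hasDerivAt_pow 3 x).const_mul _).sub ((hasDerivAt_id x).const_mul _)).mul
          (hasDerivAt_sqrt_four_sq_sub hx.1)).sub
          ((hasDerivAt_log_two_mul_add_sqrt hx.1).const_mul _))).add
        (((hasDerivAt_pow 5 x).const_mul _).add ((hasDerivAt_pow 3 x).const_mul _))).const_mul _
        |>.congr_deriv ?_
      -- With the root as a letter w, clearing denominators leaves a polynomial identity modulo w² =
      -- 4x² − 3.
      generalize √(4 * x ^ 2 - 3) = w at hw hw2 ⊢
      norm_num
      field_simp
      ring_nf
      simp only [hw2]
      ring)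
  refine ⟨h.1, h.2.trans ?_⟩
  have hs : √3 ^ 2 = (3 : ℝ) := Real.sq_sqrt (by norm_num)
  have hq : √(4 * √3 ^ 2 - 3) = 3 := by
    rw [hs, show (4 : ℝ) * 3 - 3 = 3 ^ 2 by norm_num, Real.sqrt_sq (by norm_num)]
  have hr : √3 / (2 * √3) = 1 / 2 := by field_simp
  have hone : √(4 * 1 ^ 2 - 3 : ℝ) = 1 := by norm_num
  simp only [hq, hr, arcsin_one_half, hone, mul_one, arcsin_sqrt_three_div_two]
  norm_num
  simp only [div_eq_mul_inv, mul_inv, inv_sqrt_three]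
  ring_nf
  simp only [show √3 ^ 6 = (√3 ^ 2) ^ 3 by ring, show √3 ^ 4 = (√3 ^ 2) ^ 2 by ring,
    show √3 ^ 3 = √3 * √3 ^ 2 by ring, hs]
  ring

theorem integral_sq_mul_density_one_sqrt_three :
    IntervalIntegrable (fun x => x ^ 2 * hexagonDistanceDensity x) volume 1 √3 ∧
    ∫ x in (1 : ℝ)..√3, x ^ 2 * hexagonDistanceDensity x =
      2 / 3 * (7 * (Real.pi / √3) - 459 / 40 - 25 / 54 * (Real.pi / √3) + 157 / 360) := by
  have h13 : 1 < √3 := (Real.lt_sqrt (by norm_num)).2 (by norm_num)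
  have hne : ∀ x ∈ Set.Icc 1 √3, 2 * x ≠ 0 := fun x hx => by linarith [hx.1]
  have h := intervalIntegral_eq_sub_of_eqOn_Ioc h13.le
    (f := fun x => x ^ 2 * hexagonDistanceDensity x)
    (F := fun x => 2 / 3 * (-(4 / √3) * ((1 / 9 * x ^ 6 + 1 / 4 * x ^ 4)
        * Real.arcsin (√3 / (2 * x)))
      + (-(19 / 45) * x ^ 4 - 1 / 180 * x ^ 2 - 1 / 120) * √(4 * x ^ 2 - 3)
      + (Real.pi / (9 * √3) * x ^ 6 + 5 * Real.pi / (6 * √3) * x ^ 4)))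
    (fun x hx => by rw [hexagonDistanceDensity_of_mem_Ioc_one_sqrt_three hx])
    (by fun_prop (disch := assumption)) (by fun_prop (disch := assumption)) (fun x hx => by
      have hx0 : 0 < x := by linarith [hx.1]
      have hw : 0 < √(4 * x ^ 2 - 3) := Real.sqrt_pos.2 (by nlinarith [hx.1])
      have hw2 : √(4 * x ^ 2 - 3) ^ 2 = 4 * x ^ 2 - 3 := Real.sq_sqrt (by nlinarith [hx.1])
      refine (((((((hasDerivAt_pow 6 x).const_mul _).add ((hasDerivAt_pow 4 x).const_mul _)).mul
        (hasDerivAt_arcsin_sqrt_three_div_two_mul hx.1)).const_mul _).add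
        (((((hasDerivAt_pow 4 x).const_mul _).sub ((hasDerivAt_pow 2 x).const_mul _)).sub_const _).mul
          (hasDerivAt_sqrt_four_sq_sub hx.1))).add
        (((hasDerivAt_pow 6 x).const_mul _).add ((hasDerivAt_pow 4 x).const_mul _))).const_mul _
        |>.congr_deriv ?_
      generalize √(4 * x ^ 2 - 3) = w at hw hw2 ⊢
      norm_num
      field_simp
      ring_nf
      simp only [hw2]
      ring)
  refine ⟨h.1, h.2.trans ?_⟩
  have hs : √3 ^ 2 = (3 : ℝ) := Real.sq_sqrt (by norm_num)
  have hq : √(4 * √3 ^ 2 - 3) = 3 := by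
    rw [hs, show (4 : ℝ) * 3 - 3 = 3 ^ 2 by norm_num, Real.sqrt_sq (by norm_num)]
  have hr : √3 / (2 * √3) = 1 / 2 := by field_simp
  have hone : √(4 * 1 ^ 2 - 3 : ℝ) = 1 := by norm_num
  simp only [hq, hr, arcsin_one_half, hone, mul_one, arcsin_sqrt_three_div_two]
  norm_num
  simp only [div_eq_mul_inv, mul_inv, inv_sqrt_three]
  ring_nf
  simp only [show √3 ^ 5 = √3 * (√3 ^ 2) ^ 2 by ring, show √3 ^ 4 = (√3 ^ 2) ^ 2 by ring,
    show √3 ^ 7 = √3 * (√3 ^ 2) ^ 3 by ring, hs]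
  ring

theorem integral_mul_density_sqrt_three_two :
    IntervalIntegrable (fun x => x * hexagonDistanceDensity x) volume √3 2 ∧
    ∫ x in √3..2, x * hexagonDistanceDensity x =
      2 / 3 * (-(2 / 15) + 7 / 10 * Real.log 3 - 46 / 15 * Real.pi + 26 / 5 * √3) := by
  have h32 : √3 < 2 := (Real.sqrt_lt' (by norm_num)).2 (by norm_num)
  have h3 : 0 < √3 := by positivity
  have hne : ∀ x ∈ Set.Icc √3 2, x ≠ 0 := fun x hx => by linarith [hx.1]
  have hlog : ∀ x ∈ Set.Icc √3 2, x + √(x ^ 2 - 3) ≠ 0 := fun x hx => by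
    linarith [hx.1, Real.sqrt_nonneg (x ^ 2 - 3)]
  have hs : √3 ^ 2 = (3 : ℝ) := Real.sq_sqrt (by norm_num)
  have h := intervalIntegral_eq_sub_of_eqOn_Ioc h32.le
    (f := fun x => x * hexagonDistanceDensity x)
    -- Again by parts, from a primitive of x²(x²/3 + 4). The root and arcsin(√3/x) are singular at x
    -- = √3, so differentiability is claimed only on the open interval.
    (F := fun x => 2 / 3 * (4 / √3 * ((1 / 15 * x ^ 5 + 4 / 3 * x ^ 3) * Real.arcsin (√3 / x))
      + ((26 / 15 * x ^ 3 + 7 / 15 * x) * √(x ^ 2 - 3) + 7 / 5 * Real.log (x + √(x ^ 2 - 3)))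
      - ((4 * Real.pi / (9 * √3) + 2 / 3) / 5 * x ^ 5
        + (16 * Real.pi / (3 * √3) + 4) / 3 * x ^ 3)))
    (fun x hx => by rw [hexagonDistanceDensity_of_mem_Ioc_sqrt_three_two hx])
    (by fun_prop (disch := assumption)) (by fun_prop (disch := assumption)) (fun x hx => by
      have hx0 : 0 < x := by linarith [hx.1]
      have hx3 : 3 < x ^ 2 := (Real.sqrt_lt' hx0).1 hx.1
      have hw : 0 < √(x ^ 2 - 3) := Real.sqrt_pos.2 (by linarith)
      have hw2 : √(x ^ 2 - 3) ^ 2 = x ^ 2 - 3 := Real.sq_sqrt (by linarith)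
      refine (((((((hasDerivAt_pow 5 x).const_mul _).add ((hasDerivAt_pow 3 x).const_mul _)).mul
        (hasDerivAt_arcsin_const_div h3 hx.1)).const_mul _).add
        (((((hasDerivAt_pow 3 x).const_mul _).add ((hasDerivAt_id x).const_mul _)).mul
          (hasDerivAt_sqrt_sq_sub hx.1)).add
          ((hasDerivAt_log_add_sqrt hx.1).const_mul _))).sub
        (((hasDerivAt_pow 5 x).const_mul _).add ((hasDerivAt_pow 3 x).const_mul _))).const_mul _
        |>.congr_deriv ?_
      rw [hs]
      generalize √(x ^ 2 - 3) = w at hw hw2 ⊢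
      norm_num
      field_simp
      ring_nf
      simp only [hw2]
      ring)
  refine ⟨h.1, h.2.trans ?_⟩
  have hone : √(2 ^ 2 - 3 : ℝ) = 1 := by norm_num
  have hlog3 : Real.log √3 = Real.log 3 / 2 := Real.log_sqrt (by norm_num)
  simp only [hs, hone, arcsin_sqrt_three_div_two, div_self h3.ne', Real.arcsin_one]
  norm_num [hlog3]
  simp only [div_eq_mul_inv, mul_inv, inv_sqrt_three]
  ring_nf
  simp only [show √3 ^ 6 = (√3 ^ 2) ^ 3 by ring, show √3 ^ 5 = √3 * (√3 ^ 2) ^ 2 by ring,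
    show √3 ^ 4 = (√3 ^ 2) ^ 2 by ring, show √3 ^ 3 = √3 * √3 ^ 2 by ring, hs]
  ring

theorem integral_sq_mul_density_sqrt_three_two :
    IntervalIntegrable (fun x => x ^ 2 * hexagonDistanceDensity x) volume √3 2 ∧
    ∫ x in √3..2, x ^ 2 * hexagonDistanceDensity x =
      2 / 3 * (32 / 45 - 7 * (Real.pi / √3) + 12) := by
  have h32 : √3 < 2 := (Real.sqrt_lt' (by norm_num)).2 (by norm_num)
  have h3 : 0 < √3 := by positivity
  have hne : ∀ x ∈ Set.Icc √3 2, x ≠ 0 := fun x hx => by linarith [hx.1]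
  have hs : √3 ^ 2 = (3 : ℝ) := Real.sq_sqrt (by norm_num)
  have h := intervalIntegral_eq_sub_of_eqOn_Ioc h32.le
    (f := fun x => x ^ 2 * hexagonDistanceDensity x)
    (F := fun x => 2 / 3 * (4 / √3 * ((1 / 18 * x ^ 6 + x ^ 4) * Real.arcsin (√3 / x))
      + (62 / 45 * x ^ 4 + 8 / 45 * x ^ 2 + 16 / 15) * √(x ^ 2 - 3)
      - ((4 * Real.pi / (9 * √3) + 2 / 3) / 6 * x ^ 6
        + (16 * Real.pi / (3 * √3) + 4) / 4 * x ^ 4)))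
    (fun x hx => by rw [hexagonDistanceDensity_of_mem_Ioc_sqrt_three_two hx])
    (by fun_prop (disch := assumption)) (by fun_prop (disch := assumption)) (fun x hx => by
      have hx0 : 0 < x := by linarith [hx.1]
      have hx3 : 3 < x ^ 2 := (Real.sqrt_lt' hx0).1 hx.1
      have hw : 0 < √(x ^ 2 - 3) := Real.sqrt_pos.2 (by linarith)
      have hw2 : √(x ^ 2 - 3) ^ 2 = x ^ 2 - 3 := Real.sq_sqrt (by linarith)
      refine (((((((hasDerivAt_pow 6 x).const_mul _).add (hasDerivAt_pow 4 x)).mul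
        (hasDerivAt_arcsin_const_div h3 hx.1)).const_mul _).add
        (((((hasDerivAt_pow 4 x).const_mul _).add ((hasDerivAt_pow 2 x).const_mul _)).add_const _).mul
          (hasDerivAt_sqrt_sq_sub hx.1))).sub
        (((hasDerivAt_pow 6 x).const_mul _).add ((hasDerivAt_pow 4 x).const_mul _))).const_mul _
        |>.congr_deriv ?_
      rw [hs]
      generalize √(x ^ 2 - 3) = w at hw hw2 ⊢
      norm_num
      field_simp
      ring_nf
      simp only [hw2]
      ring)
  refine ⟨h.1, h.2.trans ?_⟩
  have hone : √(2 ^ 2 - 3 : ℝ) = 1 := by norm_num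
  have hlog3 : Real.log √3 = Real.log 3 / 2 := Real.log_sqrt (by norm_num)
  simp only [hs, hone, arcsin_sqrt_three_div_two, div_self h3.ne', Real.arcsin_one]
  norm_num [hlog3]
  simp only [div_eq_mul_inv, mul_inv, inv_sqrt_three]
  ring_nf
  simp only [show √3 ^ 6 = (√3 ^ 2) ^ 3 by ring, show √3 ^ 5 = √3 * (√3 ^ 2) ^ 2 by ring,
    show √3 ^ 4 = (√3 ^ 2) ^ 2 by ring, show √3 ^ 7 = √3 * (√3 ^ 2) ^ 3 by ring, hs]
  ring

theorem integral_mul_hexagonDistanceDensity :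
    IntervalIntegrable (fun x => x * hexagonDistanceDensity x) volume 0 2 ∧
      ∫ x in (0 : ℝ)..2, x * hexagonDistanceDensity x = hexagonMeanDistance := by
  obtain ⟨i1, e1⟩ := integral_mul_density_zero_one
  obtain ⟨i2, e2⟩ := integral_mul_density_one_sqrt_three
  obtain ⟨i3, e3⟩ := integral_mul_density_sqrt_three_two
  refine ⟨(i1.trans i2).trans i3, ?_⟩
  rw [← intervalIntegral.integral_add_adjacent_intervals (i1.trans i2) i3,
    ← intervalIntegral.integral_add_adjacent_intervals i1 i2, e1, e2, e3, hexagonMeanDistance]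
  -- All terms in π have cancelled; only log 3 remains to be split into the two logarithms of the
  -- closed form.
  linear_combination (-29 / 60 : ℝ) * log_two_sqrt_three_add_log

theorem integral_sq_mul_hexagonDistanceDensity :
    IntervalIntegrable (fun x => x ^ 2 * hexagonDistanceDensity x) volume 0 2 ∧
      ∫ x in (0 : ℝ)..2, x ^ 2 * hexagonDistanceDensity x = 5 / 6 := by
  obtain ⟨i1, e1⟩ := integral_sq_mul_density_zero_one
  obtain ⟨i2, e2⟩ := integral_sq_mul_density_one_sqrt_three
  obtain ⟨i3, e3⟩ := integral_sq_mul_density_sqrt_three_two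
  refine ⟨(i1.trans i2).trans i3, ?_⟩
  rw [← intervalIntegral.integral_add_adjacent_intervals (i1.trans i2) i3,
    ← intervalIntegral.integral_add_adjacent_intervals i1 i2, e1, e2, e3]
  ring

/-! ### The model hexagon and its covariogram -/

/-- The regular hexagon in the oblique coordinates with respect to two adjacent vertices. -/
def hexagonModel : Set (ℝ × ℝ) := {p | |p.1| ≤ 1 ∧ |p.2| ≤ 1 ∧ |p.1 + p.2| ≤ 1}

/-- The indicator function of `hexagonModel`. -/
noncomputable def hexagonModelIndicator : ℝ × ℝ → ℝ := hexagonModel.indicator fun _ => 1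

/-- The area of the intersection of the model hexagon with its translate by `-v`. -/
noncomputable def hexagonCovariogram (v : ℝ × ℝ) : ℝ :=
  ∫ q, hexagonModelIndicator q * hexagonModelIndicator (q + v)

theorem isClosed_hexagonModel : IsClosed hexagonModel := by
  have h1 : IsClosed {p : ℝ × ℝ | |p.1| ≤ 1} := isClosed_le (by fun_prop) continuous_const
  have h2 : IsClosed {p : ℝ × ℝ | |p.2| ≤ 1} := isClosed_le (by fun_prop) continuous_const
  have h3 : IsClosed {p : ℝ × ℝ | |p.1 + p.2| ≤ 1} := isClosed_le (by fun_prop) continuous_const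
  exact h1.inter (h2.inter h3)

theorem hexagonModel_subset : hexagonModel ⊆ Set.Icc (-1, -1) (1, 1) := fun _ hp =>
  ⟨⟨(abs_le.1 hp.1).1, (abs_le.1 hp.2.1).1⟩, ⟨(abs_le.1 hp.1).2, (abs_le.1 hp.2.1).2⟩⟩

theorem isCompact_hexagonModel : IsCompact hexagonModel :=
  isCompact_Icc.of_isClosed_subset isClosed_hexagonModel hexagonModel_subset

theorem measurable_hexagonModelIndicator : Measurable hexagonModelIndicator :=
  measurable_const.indicator isClosed_hexagonModel.measurableSet

theorem integrable_hexagonModelIndicator : Integrable hexagonModelIndicator :=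
  (integrable_indicator_iff isClosed_hexagonModel.measurableSet).2
    (continuousOn_const.integrableOn_compact isCompact_hexagonModel)

theorem norm_hexagonModelIndicator_le (p : ℝ × ℝ) : ‖hexagonModelIndicator p‖ ≤ 1 := by
  by_cases h : p ∈ hexagonModel <;> simp [hexagonModelIndicator, h]

theorem integrable_hexagonModelIndicator_mul (v : ℝ × ℝ) :
    Integrable fun q => hexagonModelIndicator q * hexagonModelIndicator (q + v) :=
  integrable_hexagonModelIndicator.mul_bdd (c := 1)
    (measurable_hexagonModelIndicator.comp (measurable_id.add_const v)).aestronglyMeasurable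
    (Filter.Eventually.of_forall fun _ => norm_hexagonModelIndicator_le _)

/-- The upper limit may be negative: it will be 1 − u with u up to 2, so a single formula covers u ≤
1 and u ≥ 1. -/
theorem integral_max_zero {a b : ℝ} (ha : a ≤ 0) :
    ∫ x in a..b, max x 0 = max b 0 ^ 2 / 2 := by
  have hcont : Continuous fun x : ℝ => max x 0 := by fun_prop
  have h1 : ∀ c ≤ (0 : ℝ), ∫ x in c..0, max x 0 = 0 := fun c hc => by
    rw [intervalIntegral.integral_congr (g := fun _ => (0 : ℝ)), intervalIntegral.integral_zero]
    intro x hx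
    rw [Set.uIcc_of_le hc] at hx
    exact max_eq_right hx.2
  rw [← intervalIntegral.integral_add_adjacent_intervals (b := 0)
    (hcont.intervalIntegrable _ _) (hcont.intervalIntegrable _ _), h1 a ha]
  rcases le_total b 0 with hb | hb
  · rw [intervalIntegral.integral_symm, h1 b hb, max_eq_right hb]
    simp
  · rw [intervalIntegral.integral_congr (g := fun x => x), integral_id, max_eq_left hb]
    · ring
    · intro x hx
      rw [Set.uIcc_of_le hb] at hx
      exact max_eq_left hx.1

/-- For 0 ≤ w ≤ u most constraints are redundant: a ranges over [−1, 1 − u], and the section in b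
runs from max(−1, −1 − a) to min(1 − w, 1 − u − w − a). The formula is the length of this interval,
truncated at 0. -/
theorem integral_hexagonModelIndicator_section {u w : ℝ} (hw : 0 ≤ w) (hwu : w ≤ u) (a : ℝ) :
    ∫ b, hexagonModelIndicator (a, b) * hexagonModelIndicator ((a, b) + (u, w)) =
      (Set.Icc (-1) (1 - u)).indicator
        (fun a => max (2 - u - w - max (-u - a) 0 - max a 0) 0) a := by
  by_cases ha : a ∈ Set.Icc (-1) (1 - u)
  · obtain ⟨ha1, ha2⟩ := ha
    have hfun : (fun b => hexagonModelIndicator (a, b) * hexagonModelIndicator ((a, b) + (u, w))) =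
        (Set.Icc (max (-1) (-1 - a)) (min (1 - w) (1 - u - w - a))).indicator fun _ => 1 := by
      funext b
      have : (a, b) ∈ hexagonModel ∧ (a, b) + (u, w) ∈ hexagonModel ↔
          b ∈ Set.Icc (max (-1) (-1 - a)) (min (1 - w) (1 - u - w - a)) := by
        simp only [hexagonModel, Set.mem_ofPred_eq, Prod.mk_add_mk, abs_le, Set.mem_Icc, max_le_iff,
          le_min_iff]
        constructor
        · rintro ⟨⟨-, h1, h2⟩, -, h3, h4⟩
          refine ⟨⟨?_, ?_⟩, ?_, ?_⟩ <;> linarith [h1.1, h2.1, h3.2, h4.2]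
        · rintro ⟨⟨h1, h2⟩, h3, h4⟩
          refine ⟨⟨⟨?_, ?_⟩, ⟨?_, ?_⟩, ?_, ?_⟩, ⟨?_, ?_⟩, ⟨?_, ?_⟩, ?_, ?_⟩ <;> linarith
      by_cases h1 : (a, b) ∈ hexagonModel <;> by_cases h2 : (a, b) + (u, w) ∈ hexagonModel <;>
        simp only [h1, h2, and_true, and_false, false_iff, true_iff] at this <;>
        simp [hexagonModelIndicator, h1, h2, this, -Prod.mk_add_mk, -Set.mem_Icc]
    rw [hfun, integral_indicator measurableSet_Icc, Set.indicator_of_mem (by exact ⟨ha1, ha2⟩)]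
    simp only [integral_const, smul_eq_mul, mul_one, MeasurableSet.univ, measureReal_restrict_apply,
      Set.univ_inter, Real.volume_real_Icc]
    congr 1
    have e1 : min (1 - w) (1 - u - w - a) = 1 - u - w - a - max (-u - a) 0 := by
      rcases le_total (-u - a) 0 with h | h
      · rw [max_eq_right h, min_eq_right] <;> linarith
      · rw [max_eq_left h, min_eq_left] <;> linarith
    have e2 : max (-1) (-1 - a) = -1 - a + max a 0 := by
      rcases le_total a 0 with h | h
      · rw [max_eq_right h, max_eq_right] <;> linarith
      · rw [max_eq_left h, max_eq_left] <;> linarith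
    rw [e1, e2]
    ring
  · rw [Set.indicator_of_notMem ha]
    have hfun : (fun b => hexagonModelIndicator (a, b) * hexagonModelIndicator ((a, b) + (u, w)))
        = fun _ => 0 := by
      funext b
      by_contra hne
      obtain ⟨h1, h2⟩ := mul_ne_zero_iff.1 hne
      have h1' := Set.mem_of_indicator_ne_zero h1
      have h2' := Set.mem_of_indicator_ne_zero h2
      refine ha ⟨(abs_le.1 h1'.1).1, ?_⟩
      have := (abs_le.1 h2'.1).2
      simp only [Prod.mk_add_mk] at this
      linarith
    rw [hfun, integral_zero]

/-- If u + w ≤ 2, the section length is nonnegative on all of [−1, 1 − u], and each of its two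
positive parts integrates to (1 − u)₊²/2. If u + w ≥ 2, every section is null, and u ≥ 1, so both
sides vanish. -/
theorem hexagonCovariogram_eq {u w : ℝ} (hw : 0 ≤ w) (hwu : w ≤ u) (hu : u ≤ 2) :
    hexagonCovariogram (u, w) = (2 - u) * max (2 - u - w) 0 - max (1 - u) 0 ^ 2 := by
  rw [hexagonCovariogram, Measure.volume_eq_prod, integral_prod _
    (by rw [← Measure.volume_eq_prod]; exact integrable_hexagonModelIndicator_mul (u, w))]
  simp only [integral_hexagonModelIndicator_section hw hwu]
  rw [integral_indicator measurableSet_Icc, integral_Icc_eq_integral_Ioc,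
    ← intervalIntegral.integral_of_le (by linarith)]
  rcases le_total (u + w) 2 with h | h
  · rw [intervalIntegral.integral_congr
      (g := fun a => 2 - u - w - max (-u - a) 0 - max a 0)]
    · rw [intervalIntegral.integral_sub, intervalIntegral.integral_sub, integral_max_zero (by simp),
        intervalIntegral.integral_comp_sub_left (fun x => max x 0) (-u),
        integral_max_zero (by linarith), intervalIntegral.integral_const,
        max_eq_left (show 0 ≤ 2 - u - w by linarith), show -u - -1 = 1 - u by ring, smul_eq_mul]
      · ring
      all_goals exact Continuous.intervalIntegrable (by fun_prop) _ _
    · intro a ha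
      rw [Set.uIcc_of_le (by linarith)] at ha
      apply max_eq_left
      rcases le_total (-u - a) 0 with h1 | h1 <;> rcases le_total a 0 with h2 | h2 <;>
        simp only [h1, h2, max_eq_left, max_eq_right] <;> linarith [ha.1, ha.2]
  · rw [max_eq_right (show 2 - u - w ≤ 0 by linarith), max_eq_right (show 1 - u ≤ 0 by linarith),
      intervalIntegral.integral_congr (g := fun _ => 0)]
    · simp
    · intro a _
      apply max_eq_right
      linarith [le_max_right (-u - a) 0, le_max_right a 0]

theorem hexagonCovariogram_eq_zero {u w : ℝ} (hu : 2 < u) : hexagonCovariogram (u, w) = 0 := by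
  have hfun : (fun q => hexagonModelIndicator q * hexagonModelIndicator (q + (u, w)))
      = fun _ => 0 := by
    funext q
    by_contra hne
    obtain ⟨h1, h2⟩ := mul_ne_zero_iff.1 hne
    have h1' := (abs_le.1 (Set.mem_of_indicator_ne_zero h1).1).1
    have h2' := (abs_le.1 (Set.mem_of_indicator_ne_zero h2).1).2
    simp only [Prod.fst_add] at h2'
    linarith
  rw [hexagonCovariogram, hfun, integral_zero]

/-! ### Radial integrals -/

theorem integral_mul_max_sub_zero {g : ℝ → ℝ} (hg : Continuous g) {c k b : ℝ} (hc : 0 < c)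
    (hk : 0 ≤ k) (hkb : k ≤ c * b) :
    ∫ x in (0 : ℝ)..b, g x * max (k - c * x) 0 = ∫ x in (0 : ℝ)..(k / c), g x * (k - c * x) := by
  have hcont : Continuous fun x => g x * max (k - c * x) 0 := by fun_prop
  have hb : k / c ≤ b := (div_le_iff₀' hc).2 hkb
  rw [← intervalIntegral.integral_add_adjacent_intervals (b := k / c)
    (hcont.intervalIntegrable _ _) (hcont.intervalIntegrable _ _),
    intervalIntegral.integral_congr (a := k / c) (b := b) (g := fun _ => (0 : ℝ)),
    intervalIntegral.integral_zero, add_zero]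
  · refine intervalIntegral.integral_congr fun x hx => ?_
    rw [Set.uIcc_of_le (by positivity)] at hx
    have := (le_div_iff₀' hc).1 hx.2
    rw [max_eq_left (by linarith)]
  · intro x hx
    rw [Set.uIcc_of_le hb] at hx
    have := (div_le_iff₀' hc).1 hx.1
    simp only
    rw [max_eq_right (by linarith), mul_zero]

/-- The radial integral of the covariogram formula along the direction of slope `y`. -/
theorem integral_radial_first {y : ℝ} (hy : 0 ≤ y) :
    ∫ u in (0 : ℝ)..2, u ^ 2 * ((2 - u) * max (2 - u - u * y) 0 - max (1 - u) 0 ^ 2) =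
      8 / (3 * (1 + y) ^ 3) - 8 / (5 * (1 + y) ^ 4) - 1 / 30 := by
  have h1y : 0 < 1 + y := by linarith
  -- One factor of (1 − u)₊² goes into the continuous weight, the other is the truncated linear
  -- factor; both terms then have the shape of `integral_mul_max_sub_zero`, with cut-offs 2/(1 + y)
  -- and 1.
  have e1 : ∀ u : ℝ, u ^ 2 * ((2 - u) * max (2 - u - u * y) 0 - max (1 - u) 0 ^ 2) =
      u ^ 2 * (2 - u) * max (2 - (1 + y) * u) 0
        - u ^ 2 * max (1 - u) 0 * max (1 - 1 * u) 0 := fun u => by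
    rw [show 2 - u - u * y = 2 - (1 + y) * u by ring, one_mul]
    ring
  simp only [e1]
  rw [intervalIntegral.integral_sub (Continuous.intervalIntegrable (by fun_prop) _ _)
      (Continuous.intervalIntegrable (by fun_prop) _ _),
    integral_mul_max_sub_zero (by fun_prop) h1y (by norm_num) (by linarith),
    integral_mul_max_sub_zero (by fun_prop) one_pos (by norm_num) (by norm_num)]
  have e2 : ∫ x in (0 : ℝ)..(2 / (1 + y)), x ^ 2 * (2 - x) * (2 - (1 + y) * x) =
      8 / (3 * (1 + y) ^ 3) - 8 / (5 * (1 + y) ^ 4) := by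
    rw [intervalIntegral.integral_eq_sub_of_hasDerivAt (f := fun x => 4 / 3 * x ^ 3
      - (2 + y) / 2 * x ^ 4 + (1 + y) / 5 * x ^ 5)]
    · field_simp
      ring
    · intro x _
      refine ((((hasDerivAt_pow 3 x).const_mul _).sub ((hasDerivAt_pow 4 x).const_mul _)).add
        ((hasDerivAt_pow 5 x).const_mul _)).congr_deriv ?_
      norm_num
      ring
    · exact Continuous.intervalIntegrable (by fun_prop) _ _
  have e3 : ∫ x in (0 : ℝ)..(1 / 1), x ^ 2 * max (1 - x) 0 * (1 - 1 * x) = 1 / 30 := by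
    rw [div_one, intervalIntegral.integral_congr (g := fun x => x ^ 2 * (1 - x) ^ 2)]
    · rw [intervalIntegral.integral_eq_sub_of_hasDerivAt (f := fun x => 1 / 3 * x ^ 3
        - 1 / 2 * x ^ 4 + 1 / 5 * x ^ 5)]
      · norm_num
      · intro x _
        refine ((((hasDerivAt_pow 3 x).const_mul _).sub ((hasDerivAt_pow 4 x).const_mul _)).add
          ((hasDerivAt_pow 5 x).const_mul _)).congr_deriv ?_
        norm_num
        ring
      · exact Continuous.intervalIntegrable (by fun_prop) _ _
    · intro x hx
      rw [Set.uIcc_of_le zero_le_one] at hx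
      simp only
      rw [max_eq_left (by linarith [hx.2])]
      ring
  rw [e2, e3]

theorem integral_radial_second {y : ℝ} (hy : 0 ≤ y) :
    ∫ u in (0 : ℝ)..2, u ^ 3 * ((2 - u) * max (2 - u - u * y) 0 - max (1 - u) 0 ^ 2) =
      16 / (5 * (1 + y) ^ 4) - 32 / (15 * (1 + y) ^ 5) - 1 / 60 := by
  have h1y : 0 < 1 + y := by linarith
  have e1 : ∀ u : ℝ, u ^ 3 * ((2 - u) * max (2 - u - u * y) 0 - max (1 - u) 0 ^ 2) =
      u ^ 3 * (2 - u) * max (2 - (1 + y) * u) 0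
        - u ^ 3 * max (1 - u) 0 * max (1 - 1 * u) 0 := fun u => by
    rw [show 2 - u - u * y = 2 - (1 + y) * u by ring, one_mul]
    ring
  simp only [e1]
  rw [intervalIntegral.integral_sub (Continuous.intervalIntegrable (by fun_prop) _ _)
      (Continuous.intervalIntegrable (by fun_prop) _ _),
    integral_mul_max_sub_zero (by fun_prop) h1y (by norm_num) (by linarith),
    integral_mul_max_sub_zero (by fun_prop) one_pos (by norm_num) (by norm_num)]
  have e2 : ∫ x in (0 : ℝ)..(2 / (1 + y)), x ^ 3 * (2 - x) * (2 - (1 + y) * x) =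
      16 / (5 * (1 + y) ^ 4) - 32 / (15 * (1 + y) ^ 5) := by
    rw [intervalIntegral.integral_eq_sub_of_hasDerivAt (f := fun x => x ^ 4
      - 2 * (2 + y) / 5 * x ^ 5 + (1 + y) / 6 * x ^ 6)]
    · field_simp
      ring
    · intro x _
      refine (((hasDerivAt_pow 4 x).sub ((hasDerivAt_pow 5 x).const_mul _)).add
        ((hasDerivAt_pow 6 x).const_mul _)).congr_deriv ?_
      norm_num
      ring
    · exact Continuous.intervalIntegrable (by fun_prop) _ _
  have e3 : ∫ x in (0 : ℝ)..(1 / 1), x ^ 3 * max (1 - x) 0 * (1 - 1 * x) = 1 / 60 := by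
    rw [div_one, intervalIntegral.integral_congr (g := fun x => x ^ 3 * (1 - x) ^ 2)]
    · rw [intervalIntegral.integral_eq_sub_of_hasDerivAt (f := fun x => 1 / 4 * x ^ 4
        - 2 / 5 * x ^ 5 + 1 / 6 * x ^ 6)]
      · norm_num
      · intro x _
        refine ((((hasDerivAt_pow 4 x).const_mul _).sub ((hasDerivAt_pow 5 x).const_mul _)).add
          ((hasDerivAt_pow 6 x).const_mul _)).congr_deriv ?_
        norm_num
        ring
      · exact Continuous.intervalIntegrable (by fun_prop) _ _
    · intro x hx
      rw [Set.uIcc_of_le zero_le_one] at hx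
      simp only
      rw [max_eq_left (by linarith [hx.2])]
      ring
  rw [e2, e3]

/-! ### Symmetries and the fundamental sector -/

/-- Rotation by `π / 3` in the oblique coordinates. -/
def obliqueRotation (p : ℝ × ℝ) : ℝ × ℝ := (-p.2, p.1 + p.2)

/-- The rotation is a coordinate swap, then the shear (x, y) ↦ (x, x + y), then a sign change in the
first coordinate. -/
theorem measurePreserving_obliqueRotation : MeasurePreserving obliqueRotation := by
  have h := (((Measure.measurePreserving_neg (volume : Measure ℝ)).prod
    (MeasurePreserving.id (volume : Measure ℝ))).comp
    (measurePreserving_prod_add (volume : Measure ℝ) volume)).comp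
      (Measure.measurePreserving_swap (μ := (volume : Measure ℝ)) (ν := volume))
  convert! h using 1
  ext p <;> simp [obliqueRotation, add_comm]

theorem obliqueRotation_injective : Function.Injective obliqueRotation := by
  intro p q h
  simp only [obliqueRotation, Prod.mk.injEq] at h
  ext <;> linarith [h.1, h.2]

theorem measurableEmbedding_obliqueRotation : MeasurableEmbedding obliqueRotation :=
  Continuous.measurableEmbedding (by unfold obliqueRotation; fun_prop) obliqueRotation_injective

theorem measurePreserving_prodSwap :
    MeasurePreserving (Prod.swap : ℝ × ℝ → ℝ × ℝ) := Measure.measurePreserving_swap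

theorem measurableEmbedding_prodSwap : MeasurableEmbedding (Prod.swap : ℝ × ℝ → ℝ × ℝ) :=
  MeasurableEquiv.prodComm.measurableEmbedding

theorem hexagonModelIndicator_obliqueRotation (p : ℝ × ℝ) :
    hexagonModelIndicator (obliqueRotation p) = hexagonModelIndicator p := by
  have : obliqueRotation p ∈ hexagonModel ↔ p ∈ hexagonModel := by
    simp only [hexagonModel, obliqueRotation, Set.mem_ofPred_eq, abs_neg,
      show -p.2 + (p.1 + p.2) = p.1 by ring]
    tauto
  by_cases h : p ∈ hexagonModel <;> simp [hexagonModelIndicator, this, h]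

theorem hexagonModelIndicator_swap (p : ℝ × ℝ) :
    hexagonModelIndicator p.swap = hexagonModelIndicator p := by
  have : p.swap ∈ hexagonModel ↔ p ∈ hexagonModel := by
    simp only [hexagonModel, Set.mem_ofPred_eq, Prod.fst_swap, Prod.snd_swap, add_comm p.2]
    tauto
  by_cases h : p ∈ hexagonModel <;> simp [hexagonModelIndicator, this, h]

theorem hexagonCovariogram_obliqueRotation (v : ℝ × ℝ) :
    hexagonCovariogram (obliqueRotation v) = hexagonCovariogram v := by
  rw [hexagonCovariogram, ← measurePreserving_obliqueRotation.integral_comp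
    measurableEmbedding_obliqueRotation, hexagonCovariogram]
  congr 1
  funext q
  rw [show obliqueRotation q + obliqueRotation v = obliqueRotation (q + v) by
    ext <;> simp [obliqueRotation] <;> ring, hexagonModelIndicator_obliqueRotation,
    hexagonModelIndicator_obliqueRotation]

theorem hexagonCovariogram_swap (v : ℝ × ℝ) :
    hexagonCovariogram v.swap = hexagonCovariogram v := by
  rw [hexagonCovariogram, ← measurePreserving_prodSwap.integral_comp
    measurableEmbedding_prodSwap, hexagonCovariogram]
  congr 1
  funext q
  rw [← Prod.swap_add, hexagonModelIndicator_swap, hexagonModelIndicator_swap]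

/-- The first three lines bound the six rotated copies of the open quadrant; the diagonal bisects
the quadrant itself. Each line is the preimage of {0} under a quasi-measure-preserving map. -/
theorem ae_oblique_generic :
    ∀ᵐ v : ℝ × ℝ, v.1 ≠ 0 ∧ v.2 ≠ 0 ∧ v.1 + v.2 ≠ 0 ∧ v.1 ≠ v.2 := by
  have h0 : ∀ᵐ x : ℝ, x ≠ 0 := compl_mem_ae_iff.2 (measure_singleton 0)
  have h1 := (Measure.quasiMeasurePreserving_fst (μ := (volume : Measure ℝ))
    (ν := (volume : Measure ℝ))).ae h0
  have hsnd := Measure.quasiMeasurePreserving_snd (μ := (volume : Measure ℝ))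
    (ν := (volume : Measure ℝ))
  have h2 := hsnd.ae h0
  have h3 := (hsnd.comp (measurePreserving_prod_add volume volume).quasiMeasurePreserving).ae h0
  have h4 := (hsnd.comp (measurePreserving_prod_sub volume volume).quasiMeasurePreserving).ae h0
  rw [Measure.volume_eq_prod]
  filter_upwards [h1, h2, h3, h4] with v a1 a2 a3 a4
  exact ⟨a1, a2, a3, fun h => a4 (sub_eq_zero.2 h.symm)⟩

/-- The integral of a function with the symmetries of the regular hexagon is twelve times its
integral over a fundamental sector. -/
theorem integral_eq_twelve_mul {F : ℝ × ℝ → ℝ} (hF : Integrable F)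
    (hr : ∀ v, F (obliqueRotation v) = F v) (hs : ∀ v : ℝ × ℝ, F v.swap = F v) :
    ∫ v, F v = 12 * ∫ v, {p : ℝ × ℝ | 0 < p.2 ∧ p.2 < p.1}.indicator F v := by
  set S : Set (ℝ × ℝ) := {p | 0 < p.1 ∧ 0 < p.2} with hS
  set T : Set (ℝ × ℝ) := {p | 0 < p.2 ∧ p.2 < p.1} with hT
  have m1 : MeasurableSet {p : ℝ × ℝ | 0 < p.1} := measurableSet_lt measurable_const measurable_fst
  have m2 : MeasurableSet {p : ℝ × ℝ | 0 < p.2} := measurableSet_lt measurable_const measurable_snd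
  have mS : MeasurableSet S := m1.inter m2
  have mT : MeasurableSet T := m2.inter (measurableSet_lt measurable_snd measurable_fst)
  have hri : ∀ (k : ℕ) v, F (obliqueRotation^[k] v) = F v := by
    intro k
    induction k with
    | zero => simp
    | succ k ih => intro v; rw [Function.iterate_succ_apply, ih, hr]
  have hmp := fun k => measurePreserving_obliqueRotation.iterate k
  have hme : ∀ k, MeasurableEmbedding obliqueRotation^[k] := fun k => by
    induction k with
    | zero => exact MeasurableEmbedding.id
    | succ k ih => exact ih.comp measurableEmbedding_obliqueRotation
  -- Off the three lines, exactly one of the six rotates of v lies in the open quadrant, which is a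
  -- 60° sector of the plane.
  have stage1 : ∫ v, F v = 6 * ∫ v, S.indicator F v := by
    have hae : F =ᵐ[volume]
        fun v => ∑ k ∈ Finset.range 6, S.indicator F (obliqueRotation^[k] v) := by
      filter_upwards [ae_oblique_generic] with v ⟨ha, hb, hab, _⟩
      simp only [Set.indicator_apply, hri, Finset.sum_range_succ, Finset.range_zero,
        Finset.sum_empty, Function.iterate_succ, Function.iterate_zero, Function.comp_apply, id_eq,
        obliqueRotation, hS, Set.mem_ofPred_eq]
      obtain ⟨a, b⟩ := v
      simp only at ha hb hab ⊢
      simp only [show -b + (a + b) = a by ring, show -(a + b) + a = -b by ring,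
        show -a + -b = -(a + b) by ring, show b + -(a + b) = -a by ring, neg_neg]
      -- Of the eight sign patterns of a, b, a + b two are contradictory; the other six are the six
      -- sectors.
      rcases lt_or_gt_of_ne ha with ha | ha <;> rcases lt_or_gt_of_ne hb with hb | hb <;>
        rcases lt_or_gt_of_ne hab with hab | hab <;> first | (exfalso; linarith) | skip
      all_goals
        simp only [neg_pos, not_lt_of_gt, ha, hb, hab, and_self, and_true, and_false, if_true,
          if_false, add_zero, zero_add]
    rw [integral_congr_ae hae, integral_finsetSum]
    · simp only [(hmp _).integral_comp (hme _)]
      simp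
    · intro k _
      exact ((hmp k).integrable_comp_emb (hme k)).2 (hF.indicator mS)
  have stage2 : ∫ v, S.indicator F v = 2 * ∫ v, T.indicator F v := by
    have hae : S.indicator F =ᵐ[volume] fun v => T.indicator F v + T.indicator F v.swap := by
      filter_upwards [ae_oblique_generic] with v ⟨_, _, _, hab⟩
      simp only [Set.indicator_apply, hs, hS, hT, Set.mem_ofPred_eq, Prod.fst_swap, Prod.snd_swap]
      rcases lt_or_gt_of_ne hab with h | h
      · have : ¬ (0 < v.2 ∧ v.2 < v.1) := fun h' => by linarith [h'.2]
        rw [if_neg this, zero_add]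
        congr 1
        exact propext ⟨fun h' => ⟨h'.1, h⟩, fun h' => ⟨h'.1, h'.1.trans h⟩⟩
      · have : ¬ (0 < v.1 ∧ v.1 < v.2) := fun h' => by linarith [h'.2]
        rw [if_neg this, add_zero]
        congr 1
        exact propext ⟨fun h' => ⟨h'.2, h⟩, fun h' => ⟨h'.1.trans h, h'.1⟩⟩
    rw [integral_congr_ae hae, integral_add (hF.indicator mT),
      measurePreserving_prodSwap.integral_comp measurableEmbedding_prodSwap, two_mul]
    exact (measurePreserving_prodSwap.integrable_comp_emb measurableEmbedding_prodSwap).2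
      (hF.indicator mT)
  rw [stage1, stage2]
  ring

/-! ### From pairs of points to a slope integral -/

/-- The shear (v, q) ↦ (v + q, q) preserves measure, and Fubini integrates out q. Compactness gives
integrability on the product, and Fubini passes it on to the function of v. -/
theorem integral_hexagonModel_prod_sub {Φ : ℝ × ℝ → ℝ} (hΦ : Continuous Φ) :
    (Integrable fun v => Φ v * hexagonCovariogram v) ∧
      ∫ z in hexagonModel ×ˢ hexagonModel, Φ (z.1 - z.2) = ∫ v, Φ v * hexagonCovariogram v := by
  have mK : MeasurableSet (hexagonModel ×ˢ hexagonModel) :=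
    isClosed_hexagonModel.measurableSet.prod isClosed_hexagonModel.measurableSet
  set H : (ℝ × ℝ) × (ℝ × ℝ) → ℝ :=
    (hexagonModel ×ˢ hexagonModel).indicator fun z => Φ (z.1 - z.2) with hH
  have iH : Integrable H := (integrable_indicator_iff mK).2
    (ContinuousOn.integrableOn_compact (isCompact_hexagonModel.prod isCompact_hexagonModel)
      (by fun_prop))
  have mp : MeasurePreserving (fun z : (ℝ × ℝ) × (ℝ × ℝ) => (z.1 + z.2, z.2)) :=
    measurePreserving_add_prod volume volume
  have emb : MeasurableEmbedding (fun z : (ℝ × ℝ) × (ℝ × ℝ) => (z.1 + z.2, z.2)) := by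
    refine Continuous.measurableEmbedding (by fun_prop) fun x y h => ?_
    simp only [Prod.mk.injEq] at h
    ext1
    · have := h.1
      rw [h.2] at this
      exact add_right_cancel this
    · exact h.2
  have iH' : Integrable fun z : (ℝ × ℝ) × (ℝ × ℝ) => H (z.1 + z.2, z.2) :=
    (mp.integrable_comp_emb emb).2 iH
  have hval : ∀ v q, H (v + q, q) =
      Φ v * (hexagonModelIndicator q * hexagonModelIndicator (q + v)) := by
    intro v q
    by_cases h1 : q ∈ hexagonModel <;> by_cases h2 : q + v ∈ hexagonModel <;>
      simp [hH, hexagonModelIndicator, h1, h2, add_comm v q]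
  have hinner : ∀ v, ∫ q, H (v + q, q) = Φ v * hexagonCovariogram v := fun v => by
    simp only [hval, integral_const_mul, hexagonCovariogram]
  rw [Measure.volume_eq_prod] at iH'
  constructor
  · refine iH'.integral_prod_left.congr (Filter.Eventually.of_forall fun v => ?_)
    exact hinner v
  · rw [← integral_indicator mK, ← hH, ← mp.integral_comp emb, Measure.volume_eq_prod,
      integral_prod _ iH']
    exact integral_congr_ae (Filter.Eventually.of_forall hinner)

theorem integral_sector {Φ : ℝ × ℝ → ℝ}
    (hint : Integrable fun v => Φ v * hexagonCovariogram v) :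
    ∫ v, {p : ℝ × ℝ | 0 < p.2 ∧ p.2 < p.1}.indicator (fun v => Φ v * hexagonCovariogram v) v =
      ∫ u in (0 : ℝ)..2, ∫ w in (0 : ℝ)..u,
        Φ (u, w) * ((2 - u) * max (2 - u - w) 0 - max (1 - u) 0 ^ 2) := by
  have m2 : MeasurableSet {p : ℝ × ℝ | 0 < p.2} := measurableSet_lt measurable_const measurable_snd
  have mT : MeasurableSet {p : ℝ × ℝ | 0 < p.2 ∧ p.2 < p.1} :=
    m2.inter (measurableSet_lt measurable_snd measurable_fst)
  have hint' := hint.indicator mT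
  rw [Measure.volume_eq_prod] at hint' ⊢
  rw [integral_prod _ hint', intervalIntegral.integral_of_le zero_le_two,
    ← integral_indicator measurableSet_Ioc]
  congr 1
  funext u
  by_cases hu : u ∈ Set.Ioc (0 : ℝ) 2
  · rw [Set.indicator_of_mem hu, intervalIntegral.integral_of_le hu.1.le,
      integral_Ioc_eq_integral_Ioo, ← integral_indicator measurableSet_Ioo]
    congr 1
    funext w
    by_cases hw : w ∈ Set.Ioo 0 u
    · rw [Set.indicator_of_mem hw, Set.indicator_of_mem (by exact hw),
        hexagonCovariogram_eq hw.1.le hw.2.le hu.2]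
    · rw [Set.indicator_of_notMem hw, Set.indicator_of_notMem (by exact hw)]
  · rw [Set.indicator_of_notMem hu, integral_eq_zero_of_ae]
    refine Filter.Eventually.of_forall fun w => ?_
    by_cases hw : 0 < w ∧ w < u
    · have h2 : 2 < u := by
        by_contra h
        exact hu ⟨hw.1.trans hw.2, not_lt.1 h⟩
      exact (Set.indicator_of_mem (by exact hw) _).trans
        (by rw [hexagonCovariogram_eq_zero h2, mul_zero]; rfl)
    · exact Set.indicator_of_notMem (by exact hw) _

/-- The integral over pairs of points of the model hexagon of a function of their difference that
has the symmetries of the hexagon and is homogeneous of degree `k`. -/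
theorem integral_hexagonModel_prod_homogeneous {Φ : ℝ × ℝ → ℝ} (hΦ : Continuous Φ)
    (hr : ∀ v, Φ (obliqueRotation v) = Φ v) (hs : ∀ v : ℝ × ℝ, Φ v.swap = Φ v) (k : ℕ)
    (φ : ℝ → ℝ) (hφ : ∀ u y : ℝ, 0 ≤ u → Φ (u, u * y) = u ^ k * φ y) :
    ∫ z in hexagonModel ×ˢ hexagonModel, Φ (z.1 - z.2) =
      12 * ∫ y in (0 : ℝ)..1, φ y * ∫ u in (0 : ℝ)..2,
        u ^ (k + 1) * ((2 - u) * max (2 - u - u * y) 0 - max (1 - u) 0 ^ 2) := by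
  obtain ⟨hint, hval⟩ := integral_hexagonModel_prod_sub hΦ
  rw [hval, integral_eq_twelve_mul hint
    (fun v => by rw [hr, hexagonCovariogram_obliqueRotation])
    (fun v => by rw [hs, hexagonCovariogram_swap]), integral_sector hint]
  congr 1
  -- The substitution w = uy contributes a factor u, whence the exponent k + 1. The domain becomes a
  -- rectangle, so the order of integration can be exchanged and φ(y) taken out.
  have hsub : ∀ u : ℝ, ∫ w in (0 : ℝ)..u,
      Φ (u, w) * ((2 - u) * max (2 - u - w) 0 - max (1 - u) 0 ^ 2) =
      ∫ y in (0 : ℝ)..1, u * (Φ (u, u * y)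
        * ((2 - u) * max (2 - u - u * y) 0 - max (1 - u) 0 ^ 2)) := fun u => by
    rw [intervalIntegral.integral_const_mul, intervalIntegral.mul_integral_comp_mul_left
      (f := fun w => Φ (u, w) * ((2 - u) * max (2 - u - w) 0 - max (1 - u) 0 ^ 2)), mul_zero,
      mul_one]
  simp only [hsub]
  rw [intervalIntegral_intervalIntegral_swap]
  · refine intervalIntegral.integral_congr fun y _ => ?_
    rw [← intervalIntegral.integral_const_mul]
    refine intervalIntegral.integral_congr fun u hu => ?_
    rw [Set.uIcc_of_le zero_le_two] at hu
    rw [hφ u y hu.1]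
    ring
  · refine IntegrableOn.mono_set (ContinuousOn.integrableOn_compact
      ((isCompact_uIcc (a := (0 : ℝ)) (b := 2)).prod (isCompact_uIcc (a := (0 : ℝ)) (b := 1))) ?_)
      (Set.prod_mono Set.uIoc_subset_uIcc Set.uIoc_subset_uIcc)
    refine Continuous.continuousOn ?_
    simp only [Function.uncurry_def]
    fun_prop

/-! ### Moments and area of the model hexagon -/

/-- The square of the Euclidean norm in the oblique coordinates. -/
def obliqueNormSq (v : ℝ × ℝ) : ℝ := v.1 ^ 2 + v.1 * v.2 + v.2 ^ 2

theorem continuous_obliqueNormSq : Continuous obliqueNormSq := by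
  unfold obliqueNormSq
  fun_prop

theorem obliqueNormSq_obliqueRotation (v : ℝ × ℝ) :
    obliqueNormSq (obliqueRotation v) = obliqueNormSq v := by
  simp only [obliqueNormSq, obliqueRotation]
  ring

theorem obliqueNormSq_swap (v : ℝ × ℝ) : obliqueNormSq v.swap = obliqueNormSq v := by
  simp only [obliqueNormSq, Prod.fst_swap, Prod.snd_swap]
  ring

theorem integral_hexagonModel_sqrt_obliqueNormSq :
    ∫ z in hexagonModel ×ˢ hexagonModel, √(obliqueNormSq (z.1 - z.2)) =
      9 * hexagonMeanDistance := by
  rw [integral_hexagonModel_prod_homogeneous (Φ := fun v => √(obliqueNormSq v))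
    continuous_obliqueNormSq.sqrt (fun v => by rw [obliqueNormSq_obliqueRotation])
    (fun v => by rw [obliqueNormSq_swap]) 1 (fun y => √(1 + y + y ^ 2)) fun u y hu => by
      rw [obliqueNormSq, show u ^ 2 + u * (u * y) + (u * y) ^ 2 = u ^ 2 * (1 + y + y ^ 2) by ring,
        Real.sqrt_mul (sq_nonneg u), Real.sqrt_sq hu, pow_one]]
  have h := integral_sqrt_meanWeight
  rw [intervalIntegral.integral_congr (g := fun y => √(1 + y + y ^ 2) *
    (8 / (3 * (1 + y) ^ 3) - 8 / (5 * (1 + y) ^ 4) - 1 / 30)), h]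
  · ring
  · intro y hy
    rw [Set.uIcc_of_le zero_le_one] at hy
    simp only
    rw [← integral_radial_first hy.1]

theorem integral_hexagonModel_obliqueNormSq :
    ∫ z in hexagonModel ×ˢ hexagonModel, obliqueNormSq (z.1 - z.2) = 9 * (5 / 6) := by
  rw [integral_hexagonModel_prod_homogeneous continuous_obliqueNormSq obliqueNormSq_obliqueRotation
    obliqueNormSq_swap 2 (fun y => 1 + y + y ^ 2) fun u y _ => by
      rw [obliqueNormSq]
      ring]
  rw [intervalIntegral.integral_congr (g := fun y => (1 + y + y ^ 2) *
    (16 / (5 * (1 + y) ^ 4) - 32 / (15 * (1 + y) ^ 5) - 1 / 60)), integral_secondMomentWeight]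
  · norm_num
  · intro y hy
    rw [Set.uIcc_of_le zero_le_one] at hy
    simp only
    rw [← integral_radial_second hy.1]

/-- The area is the covariogram at 0, namely 2 · 2 − 1. -/
theorem volume_hexagonModel : volume hexagonModel = 3 := by
  have h := hexagonCovariogram_eq (u := 0) (w := 0) le_rfl le_rfl zero_le_two
  have hsq : ∀ q, hexagonModelIndicator q * hexagonModelIndicator (q + (0, 0))
      = hexagonModelIndicator q := fun q => by
    rw [show ((0 : ℝ), (0 : ℝ)) = 0 from rfl, add_zero]
    by_cases hq : q ∈ hexagonModel <;> simp [hexagonModelIndicator, hq]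
  simp only [hexagonCovariogram, hsq] at h
  rw [hexagonModelIndicator, integral_indicator isClosed_hexagonModel.measurableSet] at h
  simp only [integral_const, MeasurableSet.univ, measureReal_restrict_apply, Set.univ_inter,
    smul_eq_mul, mul_one] at h
  norm_num [Measure.real] at h
  rw [← ENNReal.ofReal_toReal isCompact_hexagonModel.measure_lt_top.ne, h]
  norm_num

/-! ### From oblique coordinates to the plane -/

theorem exp_pi_div_three_mul_I :
    Complex.exp (((Real.pi / 3 : ℝ) : ℂ) * Complex.I) = ⟨1 / 2, √3 / 2⟩ := by
  rw [Complex.exp_mul_I, ← Complex.ofReal_cos, ← Complex.ofReal_sin, Real.cos_pi_div_three,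
    Real.sin_pi_div_three]
  apply Complex.ext <;> simp

/-- The vertices of the model hexagon. -/
def modelVertex : Fin 6 → ℝ × ℝ := ![(1, 0), (0, 1), (-1, 1), (-1, 0), (0, -1), (1, -1)]

/-- The linear map from oblique coordinates to the plane with first basis vector `e`. -/
noncomputable def obliqueLinearMap (e : ℂ) : ℝ × ℝ →ₗ[ℝ] ℂ where
  toFun p := (p.1 + p.2 * ⟨1 / 2, √3 / 2⟩) * e
  map_add' p q := by simp; ring
  map_smul' r p := by simp; ring

theorem norm_obliqueLinearMap (e : ℂ) (p : ℝ × ℝ) :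
    ‖obliqueLinearMap e p‖ = ‖e‖ * √(obliqueNormSq p) := by
  have h3 : √3 ^ 2 = (3 : ℝ) := Real.sq_sqrt (by norm_num)
  have : Complex.normSq (p.1 + p.2 * ⟨1 / 2, √3 / 2⟩) = obliqueNormSq p := by
    simp [Complex.normSq_apply, obliqueNormSq]
    linear_combination p.2 ^ 2 / 4 * h3
  change ‖((p.1 : ℂ) + p.2 * ⟨1 / 2, √3 / 2⟩) * e‖ = _
  rw [norm_mul, mul_comm, ← this, ← Complex.norm_def]

theorem obliqueLinearMap_injective {e : ℂ} (he : e ≠ 0) :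
    Function.Injective (obliqueLinearMap e) := by
  rw [← LinearMap.ker_eq_bot, LinearMap.ker_eq_bot']
  intro p hp
  have h := norm_obliqueLinearMap e p
  rw [hp, norm_zero, zero_eq_mul, or_iff_right (norm_ne_zero_iff.2 he)] at h
  have hle := Real.sqrt_eq_zero'.1 h
  simp only [obliqueNormSq] at hle
  have h2 : p.2 = 0 := by nlinarith [sq_nonneg (2 * p.1 + p.2), sq_nonneg p.2]
  have h1 : p.1 = 0 := by
    rw [h2] at hle
    nlinarith [sq_nonneg p.1]
  exact Prod.ext h1 h2

/-- The k-th vertex is c + eωᵏ with e = s·exp(iθ), and ω² = ω − 1 reduces every power of ω to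
integer coordinates in the basis 1, ω. -/
theorem hexagonVertex_eq (c : ℂ) (s θ : ℝ) (k : Fin 6) :
    hexagonVertex c s θ k =
      c + obliqueLinearMap ((s : ℂ) * Complex.exp ((θ : ℂ) * Complex.I)) (modelVertex k) := by
  have h3 : √3 ^ 2 = (3 : ℝ) := Real.sq_sqrt (by norm_num)
  set ω : ℂ := ⟨1 / 2, √3 / 2⟩ with hω
  have hω2 : ω ^ 2 = ω - 1 := by
    apply Complex.ext
    · simp [hω, pow_two]
      linear_combination (-1 / 4 : ℝ) * h3
    · simp [hω, pow_two]
      ring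
  have hexp : Complex.exp (((θ + (k : ℝ) * (Real.pi / 3) : ℝ) : ℂ) * Complex.I) =
      Complex.exp ((θ : ℂ) * Complex.I) * ω ^ (k : ℕ) := by
    rw [hω, ← exp_pi_div_three_mul_I, ← Complex.exp_nat_mul, ← Complex.exp_add]
    congr 1
    push_cast
    ring
  rw [hexagonVertex, hexp]
  change _ = c + (((modelVertex k).1 : ℂ) + (modelVertex k).2 * ω) * _
  have e3 : ω ^ 3 = -1 := by linear_combination (ω + 1) * hω2
  have e4 : ω ^ 4 = -ω := by linear_combination ω * e3
  have e5 : ω ^ 5 = 1 - ω := by linear_combination ω * e4 - hω2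
  fin_cases k <;> simp [modelVertex, hω2, e3, e4, e5] <;> ring

theorem convexHull_modelVertex : convexHull ℝ (Set.range modelVertex) = hexagonModel := by
  apply Set.Subset.antisymm
  · refine convexHull_min ?_ ?_
    · rintro _ ⟨k, rfl⟩
      fin_cases k <;> simp [modelVertex, hexagonModel]
    · intro p hp q hq a b ha hb hab
      simp only [hexagonModel, Set.mem_ofPred_eq, abs_le, Prod.fst_add, Prod.snd_add, Prod.smul_fst,
        Prod.smul_snd, smul_eq_mul] at hp hq ⊢
      obtain ⟨⟨p1, p2⟩, ⟨p3, p4⟩, p5, p6⟩ := hp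
      obtain ⟨⟨q1, q2⟩, ⟨q3, q4⟩, q5, q6⟩ := hq
      refine ⟨⟨?_, ?_⟩, ⟨?_, ?_⟩, ?_, ?_⟩ <;> nlinarith
  · set C := convexHull ℝ (Set.range modelVertex)
    have hC : Convex ℝ C := convex_convexHull ℝ _
    have hv : ∀ k, modelVertex k ∈ C := fun k => subset_convexHull ℝ _ ⟨k, rfl⟩
    -- The origin is the midpoint of the opposite vertices 0 and 3.
    have h0 : (0 : ℝ × ℝ) ∈ C := by
      have := hC (hv 0) (hv 3) (show (0 : ℝ) ≤ 1 / 2 by norm_num)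
        (show (0 : ℝ) ≤ 1 / 2 by norm_num) (by norm_num)
      simpa [modelVertex, ← Prod.zero_eq_mk] using this
    -- The triangle on the origin and two vertices lies in C. The signs of x, y and x + y then
    -- select which of the six triangles on adjacent vertices contains (x, y).
    have tri : ∀ (i j : Fin 6) (a b : ℝ), 0 ≤ a → 0 ≤ b → a + b ≤ 1 →
        a • modelVertex i + b • modelVertex j ∈ C := by
      intro i j a b ha hb hab
      rcases eq_or_lt_of_le (add_nonneg ha hb) with h | h
      · rw [show a = 0 by linarith, show b = 0 by linarith]
        simpa using h0
      · have hm := hC (hv i) (hv j) (div_nonneg ha h.le) (div_nonneg hb h.le) (by field_simp)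
        have := hC.smul_mem_of_zero_mem h0 hm ⟨h.le, hab⟩
        simpa [smul_add, smul_smul, mul_div_cancel₀ _ h.ne'] using this
    rintro ⟨x, y⟩ ⟨hx, hy, hxy⟩
    simp only [abs_le] at hx hy hxy
    rcases le_total 0 x with h1 | h1 <;> rcases le_total 0 y with h2 | h2
    · convert! tri 0 1 x y h1 h2 hxy.2 using 1
      simp [modelVertex]
    · rcases le_total 0 (x + y) with h | h
      · convert! tri 0 5 (x + y) (-y) h (by linarith) (by linarith) using 1
        simp [modelVertex]
      · convert! tri 5 4 x (-(x + y)) h1 (by linarith) (by linarith) using 1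
        simp [modelVertex]
    · rcases le_total 0 (x + y) with h | h
      · convert! tri 2 1 (-x) (x + y) (by linarith) h (by linarith) using 1
        simp [modelVertex]
      · convert! tri 3 2 (-(x + y)) y (by linarith) h2 (by linarith) using 1
        simp [modelVertex]
    · convert! tri 3 4 (-x) (-y) (by linarith) (by linarith) (by linarith) using 1
      simp [modelVertex]

theorem regularHexagon_eq_image (c : ℂ) (s θ : ℝ) :
    regularHexagon c s θ = (fun p => c + obliqueLinearMap
      ((s : ℂ) * Complex.exp ((θ : ℂ) * Complex.I)) p) '' hexagonModel := by
  set L := obliqueLinearMap ((s : ℂ) * Complex.exp ((θ : ℂ) * Complex.I))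
  let A : ℝ × ℝ →ᵃ[ℝ] ℂ := AffineMap.const ℝ (ℝ × ℝ) c + L.toAffineMap
  have hA : ⇑A = fun p => c + L p := rfl
  rw [← hA, ← convexHull_modelVertex, A.image_convexHull, regularHexagon, ← Set.range_comp]
  congr 2
  funext k
  exact hexagonVertex_eq c s θ k

/-! ### Transport of uniform laws and the moments of D -/

/-- A uniform random point of the image of a set under an affine isomorphism has the law of the
image of a uniform random point. -/
theorem cond_image_eq_map_cond {E F : Type*} [NormedAddCommGroup E] [NormedSpace ℝ E]
    [FiniteDimensional ℝ E] [MeasurableSpace E] [BorelSpace E] [NormedAddCommGroup F]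
    [NormedSpace ℝ F] [FiniteDimensional ℝ F] [MeasurableSpace F] [BorelSpace F] (μ : Measure E)
    [μ.IsAddHaarMeasure] (ν : Measure F) [ν.IsAddHaarMeasure] (L : E ≃L[ℝ] F) (c : F) {K : Set E}
    (hK : MeasurableSet K) :
    cond ν ((fun p => c + L p) '' K) = (cond μ K).map fun p => c + L p := by
  set φ : E → F := fun p => c + L p with hφ
  have hφm : MeasurableEmbedding φ :=
    (MeasurableEquiv.addLeft c).measurableEmbedding.comp L.toHomeomorph.measurableEmbedding
  -- Uniqueness of Haar measure; translation leaves it fixed. The Jacobian constant k need not be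
  -- known, since it cancels on normalising.
  have hmap : ∃ k : ENNReal, k ≠ 0 ∧ k ≠ ⊤ ∧ μ.map φ = k • ν := by
    have hk := Measure.isAddLeftInvariant_eq_smul (μ.map L) ν
    refine ⟨Measure.addHaarScalarFactor (μ.map L) ν, ?_, ENNReal.coe_ne_top, ?_⟩
    · exact_mod_cast (Measure.addHaarScalarFactor_pos_of_isAddHaarMeasure _ _).ne'
    rw [hφ, show (fun p => c + L p) = (fun x => c + x) ∘ L from rfl,
      ← Measure.map_map (measurable_const_add c) L.continuous.measurable, map_add_left_eq_self]
    exact hk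
  obtain ⟨k, hk0, hkt, hk⟩ := hmap
  have hpre : φ ⁻¹' (φ '' K) = K := Set.preimage_image_eq K hφm.injective
  have hmeas : μ K = k * ν (φ '' K) := by
    rw [← hpre, ← hφm.map_apply, hk, hpre]
    rfl
  have hres : (μ.restrict K).map φ = k • ν.restrict (φ '' K) := by
    rw [← Measure.restrict_smul, ← hk, Measure.restrict_map hφm.measurable
      (hφm.measurableSet_image.2 hK), hpre]
  rw [ProbabilityTheory.cond, ProbabilityTheory.cond, Measure.map_smul, hres, hmeas, smul_smul,
    ENNReal.mul_inv (Or.inl hk0) (Or.inl hkt), mul_right_comm, ENNReal.inv_mul_cancel hk0 hkt, one_mul]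

theorem cond_interior_of_convex {E : Type*} [NormedAddCommGroup E] [NormedSpace ℝ E]
    [FiniteDimensional ℝ E] [MeasurableSpace E] [BorelSpace E] (μ : Measure E)
    [μ.IsAddHaarMeasure] {s : Set E} (hs : Convex ℝ s) : cond μ (interior s) = cond μ s := by
  have h : interior s =ᵐ[μ] s := interior_ae_eq_of_null_frontier (hs.addHaar_frontier μ)
  rw [ProbabilityTheory.cond, ProbabilityTheory.cond, measure_congr h, Measure.restrict_congr_set h]

theorem cond_interior_regularHexagon (c : ℂ) {s : ℝ} (hs : 0 < s) (θ : ℝ) :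
    cond volume (interior (regularHexagon c s θ)) = (cond volume hexagonModel).map
      fun p => c + obliqueLinearMap ((s : ℂ) * Complex.exp ((θ : ℂ) * Complex.I)) p := by
  set e : ℂ := (s : ℂ) * Complex.exp ((θ : ℂ) * Complex.I) with he
  have he0 : e ≠ 0 := mul_ne_zero (by exact_mod_cast hs.ne') (Complex.exp_ne_zero _)
  let L : (ℝ × ℝ) ≃L[ℝ] ℂ := ((obliqueLinearMap e).linearEquivOfInjective
    (obliqueLinearMap_injective he0) (by simp)).toContinuousLinearEquiv
  have hconv : Convex ℝ (regularHexagon c s θ) := convex_convexHull ℝ _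
  rw [cond_interior_of_convex volume hconv, regularHexagon_eq_image]
  exact cond_image_eq_map_cond volume volume L c isClosed_hexagonModel.measurableSet

theorem obliqueNormSq_nonneg (v : ℝ × ℝ) : 0 ≤ obliqueNormSq v := by
  rw [obliqueNormSq]
  nlinarith [sq_nonneg (2 * v.1 + v.2), sq_nonneg v.2]

theorem dist_obliqueLinearMap (c : ℂ) {s : ℝ} (hs : 0 < s) (θ : ℝ) (p q : ℝ × ℝ) :
    dist (c + obliqueLinearMap ((s : ℂ) * Complex.exp ((θ : ℂ) * Complex.I)) p)
      (c + obliqueLinearMap ((s : ℂ) * Complex.exp ((θ : ℂ) * Complex.I)) q) =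
      s * √(obliqueNormSq (p - q)) := by
  rw [dist_add_left, dist_eq_norm, ← map_sub, norm_obliqueLinearMap, norm_mul,
    Complex.norm_exp_ofReal_mul_I, mul_one, Complex.norm_real, Real.norm_of_nonneg hs.le]

/-- Expectations of continuous functions of two independent uniform points of a regular hexagon
are averages over pairs of points of the model hexagon. -/
theorem integral_comp_of_isUniform_hexagon {Ω : Type*} [MeasurableSpace Ω] {P : Measure Ω}
    [IsProbabilityMeasure P] {c : ℂ} {s θ : ℝ} (hs : 0 < s) {X Y : Ω → ℂ}
    (hX : pdf.IsUniform X (interior (regularHexagon c s θ)) P volume)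
    (hY : pdf.IsUniform Y (interior (regularHexagon c s θ)) P volume)
    (hXY : IndepFun X Y P) {g : ℂ × ℂ → ℝ} (hg : Continuous g) :
    Integrable (fun ω => g (X ω, Y ω)) P ∧
      ∫ ω, g (X ω, Y ω) ∂P = 1 / 9 * ∫ z in hexagonModel ×ˢ hexagonModel,
        g (c + obliqueLinearMap ((s : ℂ) * Complex.exp ((θ : ℂ) * Complex.I)) z.1,
          c + obliqueLinearMap ((s : ℂ) * Complex.exp ((θ : ℂ) * Complex.I)) z.2) := by
  rw [pdf.IsUniform, cond_interior_regularHexagon c hs θ] at hX hY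
  set φ : ℝ × ℝ → ℂ :=
    fun p => c + obliqueLinearMap ((s : ℂ) * Complex.exp ((θ : ℂ) * Complex.I)) p with hφ
  have hφc : Continuous φ :=
    continuous_const.add (LinearMap.continuous_of_finiteDimensional _)
  have hprob : IsProbabilityMeasure (ProbabilityTheory.cond volume hexagonModel) :=
    cond_isProbabilityMeasure_of_finite (by rw [volume_hexagonModel]; norm_num)
      (by rw [volume_hexagonModel]; norm_num)
  -- `Measure.map` is 0 by default for a map that is not a.e. measurable, so a nonzero law forces X
  -- and Y to be a.e. measurable.
  have hmapne : (ProbabilityTheory.cond volume hexagonModel).map φ ≠ 0 := by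
    have := Measure.isProbabilityMeasure_map (μ := ProbabilityTheory.cond volume hexagonModel)
      hφc.aemeasurable
    exact IsProbabilityMeasure.ne_zero _
  have hXm : AEMeasurable X P := AEMeasurable.of_map_ne_zero (by rw [hX]; exact hmapne)
  have hYm : AEMeasurable Y P := AEMeasurable.of_map_ne_zero (by rw [hY]; exact hmapne)
  have hlaw : P.map (fun ω => (X ω, Y ω)) =
      ((ProbabilityTheory.cond volume hexagonModel).prod
        (ProbabilityTheory.cond volume hexagonModel)).map (Prod.map φ φ) := by
    rw [(indepFun_iff_map_prod_eq_prod_map_map hXm hYm).1 hXY, hX, hY,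
      Measure.map_prod_map _ _ hφc.measurable hφc.measurable]
  -- 9 is the square of the model area 3.
  have hcond : (ProbabilityTheory.cond volume hexagonModel).prod
      (ProbabilityTheory.cond volume hexagonModel) =
      (9⁻¹ : ENNReal) • (volume : Measure ((ℝ × ℝ) × (ℝ × ℝ))).restrict
        (hexagonModel ×ˢ hexagonModel) := by
    rw [ProbabilityTheory.cond, volume_hexagonModel, Measure.prod_smul_left,
      Measure.prod_smul_right, smul_smul, Measure.prod_restrict, ← Measure.volume_eq_prod,
      ← ENNReal.mul_inv (by simp) (by simp)]
    norm_num
  have hint : IntegrableOn (fun z : (ℝ × ℝ) × (ℝ × ℝ) => g (Prod.map φ φ z))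
      (hexagonModel ×ˢ hexagonModel) :=
    ContinuousOn.integrableOn_compact (isCompact_hexagonModel.prod isCompact_hexagonModel)
      (hg.comp (hφc.prodMap hφc)).continuousOn
  have hXYm : AEMeasurable (fun ω => (X ω, Y ω)) P := hXm.prodMk hYm
  have hφφ : AEMeasurable (Prod.map φ φ) ((ProbabilityTheory.cond volume hexagonModel).prod
      (ProbabilityTheory.cond volume hexagonModel)) := (hφc.prodMap hφc).aemeasurable
  constructor
  · refine (integrable_map_measure (f := fun ω => (X ω, Y ω)) (g := g)
      hg.aestronglyMeasurable hXYm).1 ?_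
    rw [hlaw, integrable_map_measure hg.aestronglyMeasurable hφφ, hcond]
    exact Integrable.smul_measure hint (by simp)
  · rw [← integral_map (f := g) hXYm hg.aestronglyMeasurable, hlaw,
      integral_map hφφ hg.aestronglyMeasurable, hcond, integral_smul_measure]
    simp [hφ, Prod.map]

theorem mainTheorem11 {Ω : Type*} [MeasurableSpace Ω] (P : Measure Ω) [IsProbabilityMeasure P]
    (c : ℂ) (s θ : ℝ) (hs : 0 < s) (X Y : Ω → ℂ)
    (hX : pdf.IsUniform X (interior (regularHexagon c s θ)) P volume)
    (hY : pdf.IsUniform Y (interior (regularHexagon c s θ)) P volume)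
    (hXY : IndepFun X Y P) :
    -- the first moment exists, and for side length `s` it is `s` times that of the unit hexagon
    (Integrable (fun ω => dist (X ω) (Y ω)) P ∧
      ∫ ω, dist (X ω) (Y ω) ∂P = s * hexagonMeanDistance) ∧
    -- the second moment
    (Integrable (fun ω => dist (X ω) (Y ω) ^ 2) P ∧
      ∫ ω, dist (X ω) (Y ω) ^ 2 ∂P = s ^ 2 * (5 / 6)) ∧
    -- the variance
    variance (fun ω => dist (X ω) (Y ω)) P = s ^ 2 * (5 / 6 - hexagonMeanDistance ^ 2) ∧
    -- the moments of the unit hexagon as integrals against the explicit density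
    (IntervalIntegrable (fun x => x * hexagonDistanceDensity x) volume 0 2 ∧
      ∫ x in (0 : ℝ)..2, x * hexagonDistanceDensity x = hexagonMeanDistance) ∧
    (IntervalIntegrable (fun x => x ^ 2 * hexagonDistanceDensity x) volume 0 2 ∧
      ∫ x in (0 : ℝ)..2, x ^ 2 * hexagonDistanceDensity x = 5 / 6) ∧
    -- the numerical values for the unit hexagon, correctly rounded to ten decimal places
    |hexagonMeanDistance - 0.8262589495| ≤ 5 / 10 ^ 11 ∧
    |5 / 6 - hexagonMeanDistance ^ 2 - 0.1506294817| ≤ 5 / 10 ^ 11 := by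
  obtain ⟨i1, e1⟩ := integral_comp_of_isUniform_hexagon hs hX hY hXY (g := fun z => dist z.1 z.2)
    (by fun_prop)
  obtain ⟨i2, e2⟩ := integral_comp_of_isUniform_hexagon hs hX hY hXY
    (g := fun z => dist z.1 z.2 ^ 2) (by fun_prop)
  simp only [dist_obliqueLinearMap c hs θ] at e1 e2
  rw [integral_const_mul, integral_hexagonModel_sqrt_obliqueNormSq] at e1
  have hsq : ∀ v, √(obliqueNormSq v) ^ 2 = obliqueNormSq v := fun v =>
    Real.sq_sqrt (obliqueNormSq_nonneg v)
  simp only [mul_pow, hsq] at e2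
  rw [integral_const_mul, integral_hexagonModel_obliqueNormSq] at e2
  have m1 : ∫ ω, dist (X ω) (Y ω) ∂P = s * hexagonMeanDistance := by rw [e1]; ring
  have m2 : ∫ ω, dist (X ω) (Y ω) ^ 2 ∂P = s ^ 2 * (5 / 6) := by rw [e2]; ring
  refine ⟨⟨i1, m1⟩, ⟨i2, m2⟩, ?_, integral_mul_hexagonDistanceDensity,
    integral_sq_mul_hexagonDistanceDensity, hexagonMeanDistance_approx,
    hexagonDistanceVariance_approx⟩
  have hmem : MemLp (fun ω => dist (X ω) (Y ω)) 2 P :=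
    (memLp_two_iff_integrable_sq i1.aestronglyMeasurable).2 i2
  rw [variance_eq_sub hmem]
  simp only [Pi.pow_apply, m1, m2]
  ring
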